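/- Notation. Fix $0<\gamma<1$. For open $B\subset\mathbb R^d$ let $\|f\|_{C^{1,\gamma}(B)}=\|f\|_{L^\infty(B)}+[f]_{C^\gamma(B)}+\|\nabla f\|_{L^\infty(B)}+[\nabla f]_{C^\gamma(B)}$, let $C^{1,\gamma}(\mathbb R^d)$ be the differentiable functions with finite norm on $\mathbb R^d$, and for $\delta>0$, $m>\delta$ let $\mathcal K(\gamma,\delta,m)=\{f\in C^{1,\gamma}(\mathbb R^d): f\ge\delta,\ \|f\|_{C^{1,\gamma}(\mathbb R^d)}\le m\}$ and $\mathcal K=\bigcup_{\delta>0}\bigcup_{m>\delta}\mathcal K(\gamma,\delta,m)$. Let $J:\mathcal K\to C^0(\mathbb R^d)$, $f\mapsto J(f,\cdot)$, satisfy: (a) for all $\delta>0$ and $m>\delta$, $\|J(f,\cdot)-J(g,\cdot)\|_{L^\infty(\mathbb R^d)}\le C(\delta,m)\|f-g\|_{C^{1,\gamma}(\mathbb R^d)}$ for all $f,g\in\mathcal K(\gamma,\delta,m)$, where $C(\delta,m)$ is non-increasing in $\delta$ and non-decreasing in $m$; (b) (global comparison property) if $f,g\in\mathcal K$, $f\le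 g$ on $\mathbb R^d$ and $f(x_0)=g(x_0)$, then $J(f,x_0)\le J(g,x_0)$; (c) (translation invariance) $J(f(\cdot+h),x)=J(f,x+h)$ for all $f\in\mathcal K$ and $h,x\in\mathbb R^d$; (d) $J(f+c,x)\le J(f,x)$ for all $f\in\mathcal K$, all constants $c>0$ and all $x\in\mathbb R^d$; (e) (splitting) for all $\delta>0$ and $m>\delta$ there are a constant $C\ge 0$ and a function $\rho\ge 0$ with $\rho(R)\to0$ as $R\to\infty$, such that for all $f,g\in\mathcal K(\gamma,\delta,m)$ and $R>1$, $$\|J(f,\cdot)-J(g,\cdot)\|_{L^\infty(B_R)}\le C\left(\|f-g\|_{C^{1,\gamma}(B_{2R})}+\rho(R)\|f-g\|_{L^\infty(\mathbb R^d)}+\rho(R)\right),$$ where $B_R$ is the open ball of radius $R$ centred at $0$. Let $T>0$. A test function is a function $\phi:\mathbb R^d\times\mathbb R\to\mathbb R$ for which there is $\beta>0$ with $\gamma+\beta<1$ such that $\phi(\cdot,s)\in C^{1,\gamma+\beta}(\mathbb R^d)$ for every $s$ and $\phi(y,\cdot)\in C^1(\mathbb R)$ for every $y$. An upper semicontinuous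 function $f$ on $\mathbb R^d\times[0,T]$ with $\inf f>0$ is a viscosity subsolution of $\partial_tf=J(f)$ if, whenever $(x,t)\in\mathbb R^d\times(0,T]$, $0<r<t$, and a test function $\phi$ satisfies $f\le\phi$ on $\mathbb R^d\times(t-r,t]$ and $f(x,t)=\phi(x,t)$, one has $\partial_t\phi(x,t)\le J(\phi(\cdot,t),x)$. A lower semicontinuous function $f$ on $\mathbb R^d\times[0,T]$ with $\inf f>0$ is a viscosity supersolution if, whenever $(x,t)\in\mathbb R^d\times(0,T]$, $0<r<t$, and a test function $\phi$ satisfies $\inf_{\mathbb R^d\times(t-r,t]}\phi>0$, $\phi\le f$ on $\mathbb R^d\times(t-r,t]$ and $f(x,t)=\phi(x,t)$, one has $\partial_t\phi(x,t)\ge J(\phi(\cdot,t),x)$. A viscosity solution is both a subsolution and a supersolution. Lemma. Let $f:\mathbb R^d\times[0,T]\to\mathbb R$ be a bounded continuous viscosity solution of $\partial_tf=J(f)$ with $f(\cdot,0)=f_0$, and let $\omega:[0,\infty)\to[0,\infty)$ satisfy $\omega(0)=0$ and $\omega(r)\to0$ as $r\to0^+$. If $|f_0(x)-f_0(y)|\le\omega(|x-y|)$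 for all $x,y\in\mathbb R^d$, then $$|f(x,t)-f(y,t)|\le\omega(|x-y|)\qquad\text{for all }x,y\in\mathbb R^d\text{ and all }t\in[0,T].$$ -/

import Mathlib

open Set Filter Topology
open scoped NNReal ENNReal

/-- The supremum norm of `f` over the set `s`, with values in `[0,∞]`. -/
noncomputable def supENorm {d : ℕ} {F : Type*} [NormedAddCommGroup F]
    (s : Set (EuclideanSpace ℝ (Fin d))) (f : EuclideanSpace ℝ (Fin d) → F) : ℝ≥0∞ :=
  ⨆ x ∈ s, ‖f x‖ₑ

/-- The `C^{1,γ}` norm over an open set `s`, with values in `[0,∞]`: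
`‖f‖_{L^∞(s)} + [f]_{C^γ(s)} + ‖∇f‖_{L^∞(s)} + [∇f]_{C^γ(s)}`. -/
noncomputable def c1HolderENorm {d : ℕ} (γ : ℝ≥0) (s : Set (EuclideanSpace ℝ (Fin d)))
    (f : EuclideanSpace ℝ (Fin d) → ℝ) : ℝ≥0∞ :=
  supENorm s f + eHolderNorm γ (s.domRestrict f)
    + supENorm s (fderiv ℝ f) + eHolderNorm γ (s.domRestrict (fderiv ℝ f))

/-- Membership in `C^{1,γ}(ℝ^d)`: `f` is differentiable with finite `C^{1,γ}` norm
(continuity of the gradient follows from its Hölder bound when `γ > 0`). -/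
def IsC1Holder {d : ℕ} (γ : ℝ≥0) (f : EuclideanSpace ℝ (Fin d) → ℝ) : Prop :=
  Differentiable ℝ f ∧ c1HolderENorm γ univ f < ∞

/-- The convex set `𝒦(γ,δ,m)` of all `f ∈ C^{1,γ}(ℝ^d)` with `f ≥ δ` and `‖f‖_{C^{1,γ}} ≤ m`. -/
def classK (d : ℕ) (γ : ℝ≥0) (δ m : ℝ) : Set (EuclideanSpace ℝ (Fin d) → ℝ) :=
  {f | IsC1Holder γ f ∧ (∀ x, δ ≤ f x) ∧ c1HolderENorm γ univ f ≤ ENNReal.ofReal m}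

/-- The domain `⋃_{δ > 0} ⋃_{m > δ} 𝒦(γ,δ,m)` of the operators considered. -/
def domK (d : ℕ) (γ : ℝ≥0) : Set (EuclideanSpace ℝ (Fin d) → ℝ) :=
  ⋃ (δ : ℝ) (_ : 0 < δ) (m : ℝ) (_ : δ < m), classK d γ δ m

/-- The class of nonlocal operators `J : ⋃_{δ > 0} ⋃_{m > δ} 𝒦(γ,δ,m) → C^0(ℝ^d)`.
`J` is given as a total function, but only its values on `domK d γ` are ever used. -/
structure IsNonlocalOperator {d : ℕ} (γ : ℝ≥0)
    (J : (EuclideanSpace ℝ (Fin d) → ℝ) → EuclideanSpace ℝ (Fin d) → ℝ) : Prop where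
  gamma_pos : 0 < γ
  gamma_lt_one : γ < 1
  /-- `J` takes values in the continuous functions. -/
  continuous_apply : ∀ f ∈ domK d γ, Continuous (J f)
  /-- `J` is Lipschitz on each `𝒦(γ,δ,m)`, from the `C^{1,γ}` norm to the supremum norm, with a
  constant that increases as `δ` decreases or `m` increases. -/
  lipschitz : ∃ C : ℝ → ℝ → ℝ≥0,
    (∀ δ δ' m m', 0 < δ' → δ' ≤ δ → δ < m → m ≤ m' → C δ m ≤ C δ' m') ∧
    ∀ δ m, 0 < δ → δ < m → ∀ f ∈ classK d γ δ m, ∀ g ∈ classK d γ δ m,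
      supENorm univ (J f - J g) ≤ C δ m * c1HolderENorm γ univ (f - g)
  /-- The global comparison property. -/
  gcp : ∀ f ∈ domK d γ, ∀ g ∈ domK d γ, (∀ x, f x ≤ g x) →
    ∀ x₀, f x₀ = g x₀ → J f x₀ ≤ J g x₀
  /-- Translation invariance. -/
  translation : ∀ f ∈ domK d γ, ∀ h x, J (fun y => f (y + h)) x = J f (x + h)
  /-- Adding a positive constant does not increase `J`. -/
  add_const_le : ∀ f ∈ domK d γ, ∀ c : ℝ, 0 < c → ∀ x, J (fun y => f y + c) x ≤ J f x
  /-- The operator splitting property. -/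
  splitting : ∀ δ m, 0 < δ → δ < m → ∃ (C : ℝ≥0) (ω : ℝ → ℝ≥0), Tendsto ω atTop (𝓝 0) ∧
    ∀ f ∈ classK d γ δ m, ∀ g ∈ classK d γ δ m, ∀ R : ℝ, 1 < R →
      supENorm (Metric.ball 0 R) (J f - J g) ≤
        C * (c1HolderENorm γ (Metric.ball 0 (2 * R)) (f - g)
          + ω R * supENorm univ (f - g) + ω R)

/-- Test functions: `C^{1,γ+β}(ℝ^d)` in space for some `β > 0` with `γ + β < 1`, and `C^1` in
time. -/
def IsTestFunction {d : ℕ} (γ : ℝ≥0) (φ : EuclideanSpace ℝ (Fin d) → ℝ → ℝ) : Prop :=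
  ∃ β : ℝ≥0, 0 < β ∧ γ + β < 1 ∧ (∀ s, IsC1Holder (γ + β) (fun y => φ y s)) ∧
    ∀ y, ContDiff ℝ 1 (φ y)

/-- `f` is a viscosity subsolution of `∂_t f = J(f)` in `ℝ^d × (0,T]`. The test function `φ` touches
`f` from above at `(x,t)`: the maximum of `f - φ` over `ℝ^d × (t-r,t]` is attained at `(x,t)`,
with value zero. -/
def IsViscositySubsolution {d : ℕ} (γ : ℝ≥0)
    (J : (EuclideanSpace ℝ (Fin d) → ℝ) → EuclideanSpace ℝ (Fin d) → ℝ) (T : ℝ)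
    (f : EuclideanSpace ℝ (Fin d) → ℝ → ℝ) : Prop :=
  UpperSemicontinuousOn (Function.uncurry f) (univ ×ˢ Icc 0 T) ∧
  (∃ δ > 0, ∀ x, ∀ t ∈ Icc 0 T, δ ≤ f x t) ∧
  ∀ x, ∀ t ∈ Ioc 0 T, ∀ φ, IsTestFunction γ φ → ∀ r, 0 < r → r < t →
    φ x t = f x t → (∀ y, ∀ s ∈ Ioc (t - r) t, f y s ≤ φ y s) →
    deriv (φ x) t ≤ J (fun y => φ y t) x

/-- `f` is a viscosity supersolution of `∂_t f = J(f)` in `ℝ^d × (0,T]`. The test function `φ`, with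
positive infimum, touches `f` from below at `(x,t)` over `ℝ^d × (t-r,t]`. -/
def IsViscositySupersolution {d : ℕ} (γ : ℝ≥0)
    (J : (EuclideanSpace ℝ (Fin d) → ℝ) → EuclideanSpace ℝ (Fin d) → ℝ) (T : ℝ)
    (f : EuclideanSpace ℝ (Fin d) → ℝ → ℝ) : Prop :=
  LowerSemicontinuousOn (Function.uncurry f) (univ ×ˢ Icc 0 T) ∧
  (∃ δ > 0, ∀ x, ∀ t ∈ Icc 0 T, δ ≤ f x t) ∧
  ∀ x, ∀ t ∈ Ioc 0 T, ∀ φ, IsTestFunction γ φ → ∀ r, 0 < r → r < t →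
    (∃ c > 0, ∀ y, ∀ s ∈ Ioc (t - r) t, c ≤ φ y s) →
    φ x t = f x t → (∀ y, ∀ s ∈ Ioc (t - r) t, φ y s ≤ f y s) →
    J (fun y => φ y t) x ≤ deriv (φ x) t

/-- `f` is a viscosity solution if it is both a subsolution and a supersolution. -/
def IsViscositySolution {d : ℕ} (γ : ℝ≥0)
    (J : (EuclideanSpace ℝ (Fin d) → ℝ) → EuclideanSpace ℝ (Fin d) → ℝ) (T : ℝ)
    (f : EuclideanSpace ℝ (Fin d) → ℝ → ℝ) : Prop :=
  IsViscositySubsolution γ J T f ∧ IsViscositySupersolution γ J T f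

/-- `ω` is a modulus of continuity: `ω(0) = 0` and `ω(r) → 0` as `r → 0+`. -/
def IsModulus (ω : ℝ → ℝ) : Prop :=
  ω 0 = 0 ∧ Tendsto ω (𝓝[>] 0) (𝓝 0)

/-! Suppose f(x,t) - f(y,t) exceeds ω(‖x - y‖) and put h = x - y. Variables are doubled with the
shifted coupling K‖x - y - h‖², a term H(t - s)² tying the two times, a term l t making the
inequality strict, and penalties P(x) + Q(y) forcing a maximum to exist (`exists_doubling_max`). A
large K rules out the initial time, because ω controls f₀.

Since J is nonlocal and nonlinear, both viscosity inequalities should be tested with essentially one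
admissible function. `exists_interposition` supplies it: the maximum property leaves room for a
C^{1,1} function g between the recentred subsolution and supersolution. Translation invariance moves
both contact points to the origin; the comparison property and monotonicity under added constants
then give l ≤ J(G + P + Q) - J(G) there, where the bounds on G involve neither H nor the contact
points (`exists_le_sub_of_doubling_max`).

The contradiction comes from making P and Q cheap. Each is S + L. The part S has height 2α, keeps
the maximum within distance 2 of a chosen almost maximum, and costs O(α) by the Lipschitz bound. The
part L has height M, gives compactness, and vanishes on a ball of radius R, so it costs little by
the splitting property. The C^{1,1} bounds of S + L are uniform in α ≤ 1 and R ≥ 1, so the constants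
of J are fixed before R and α are chosen, and the total cost stays below l. -/

/-- `f` is bounded by `B` and has, at every point, a first order expansion with quadratic error
`C ‖y - x‖²`. This is a quantitative form of membership in `C^{1,1}`. -/
def IsC11 {E : Type*} [NormedAddCommGroup E] [NormedSpace ℝ E] (B C : ℝ) (f : E → ℝ) : Prop :=
  0 ≤ C ∧ (∀ x, |f x| ≤ B) ∧
    ∀ x, ∃ L : E →L[ℝ] ℝ, ∀ y, |f y - f x - L (y - x)| ≤ C * ‖y - x‖ ^ 2

/-! ### Calculus of bounded C^{1,1} functions -/

section QuadraticError

variable {E : Type*} [NormedAddCommGroup E] [NormedSpace ℝ E]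

theorem hasFDerivAt_of_abs_sub_le_sq {f : E → ℝ} {L : E →L[ℝ] ℝ} {C : ℝ} {x : E}
    (h : ∀ y, |f y - f x - L (y - x)| ≤ C * ‖y - x‖ ^ 2) : HasFDerivAt f L x := by
  rw [hasFDerivAt_iff_isLittleO]
  have h1 : (fun y => f y - f x - L (y - x)) =O[𝓝 x] fun y => ‖y - x‖ ^ 2 :=
    Asymptotics.IsBigO.of_bound C (Eventually.of_forall fun y => by
      simpa [Real.norm_eq_abs] using h y)
  refine h1.trans_isLittleO ?_
  have h2 : (fun y : E => ‖y - x‖ ^ 2) = fun y => ‖y - x‖ * ‖y - x‖ := by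
    funext y; ring
  rw [h2]
  have h3 : (fun y : E => ‖y - x‖) =o[𝓝 x] (fun _ => (1 : ℝ)) := by
    rw [Asymptotics.isLittleO_one_iff]
    have : Continuous fun y : E => ‖y - x‖ := by fun_prop
    simpa using this.tendsto x
  simpa using h3.mul_isBigO (Asymptotics.isBigO_refl (fun y : E => ‖y - x‖) (𝓝 x)) |>.trans_isBigO
    (by simpa using (Asymptotics.isBigO_refl (fun y : E => (y - x)) (𝓝 x)).norm_left)

namespace IsC11

variable {B B' C C' : ℝ} {f g : E → ℝ}

theorem bound_nonneg (hf : IsC11 B C f) : 0 ≤ B := (abs_nonneg _).trans (hf.2.1 0)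

theorem mono (hf : IsC11 B C f) (hB : B ≤ B') (hC : C ≤ C') : IsC11 B' C' f := by
  refine ⟨hf.1.trans hC, fun x => (hf.2.1 x).trans hB, fun x => ?_⟩
  obtain ⟨L, hL⟩ := hf.2.2 x
  exact ⟨L, fun y => (hL y).trans (by gcongr)⟩

theorem const (c : ℝ) : IsC11 |c| 0 (fun _ : E => c) :=
  ⟨le_rfl, fun _ => le_rfl, fun _ => ⟨0, fun _ => by simp⟩⟩

theorem add (hf : IsC11 B C f) (hg : IsC11 B' C' g) :
    IsC11 (B + B') (C + C') (fun x => f x + g x) := by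
  refine ⟨add_nonneg hf.1 hg.1, fun x => (abs_add_le _ _).trans (add_le_add (hf.2.1 x) (hg.2.1 x)),
    fun x => ?_⟩
  obtain ⟨L, hL⟩ := hf.2.2 x
  obtain ⟨L', hL'⟩ := hg.2.2 x
  refine ⟨L + L', fun y => ?_⟩
  have e : f y + g y - (f x + g x) - (L + L') (y - x)
      = (f y - f x - L (y - x)) + (g y - g x - L' (y - x)) := by
    rw [add_apply]; ring
  rw [e, add_mul]
  exact (abs_add_le _ _).trans (add_le_add (hL y) (hL' y))

theorem const_mul (hf : IsC11 B C f) {a : ℝ} (ha : 0 ≤ a) :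
    IsC11 (a * B) (a * C) (fun x => a * f x) := by
  refine ⟨mul_nonneg ha hf.1, fun x => ?_, fun x => ?_⟩
  · rw [abs_mul, abs_of_nonneg ha]; exact mul_le_mul_of_nonneg_left (hf.2.1 x) ha
  · obtain ⟨L, hL⟩ := hf.2.2 x
    refine ⟨a • L, fun y => ?_⟩
    have e : a * f y - a * f x - (a • L) (y - x) = a * (f y - f x - L (y - x)) := by
      rw [smul_apply, smul_eq_mul]; ring
    rw [e, abs_mul, abs_of_nonneg ha, mul_assoc]
    exact mul_le_mul_of_nonneg_left (hL y) ha

theorem neg (hf : IsC11 B C f) : IsC11 B C (fun x => -f x) := by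
  refine ⟨hf.1, fun x => by rw [abs_neg]; exact hf.2.1 x, fun x => ?_⟩
  obtain ⟨L, hL⟩ := hf.2.2 x
  refine ⟨-L, fun y => ?_⟩
  have e : -f y - -f x - (-L) (y - x) = -(f y - f x - L (y - x)) := by
    rw [neg_apply]; ring
  rw [e, abs_neg]
  exact hL y

theorem comp_add_right (hf : IsC11 B C f) (h : E) : IsC11 B C (fun x => f (x + h)) := by
  refine ⟨hf.1, fun x => hf.2.1 _, fun x => ?_⟩
  obtain ⟨L, hL⟩ := hf.2.2 (x + h)
  exact ⟨L, fun y => by simpa using hL (y + h)⟩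

/-- Keeps the constants of a cutoff uniform when it is dilated to scale R ≥ 1. -/
theorem comp_smul (hf : IsC11 B C f) {c : ℝ} (hc : |c| ≤ 1) : IsC11 B C (fun x => f (c • x)) := by
  refine ⟨hf.1, fun x => hf.2.1 _, fun x => ?_⟩
  obtain ⟨L, hL⟩ := hf.2.2 (c • x)
  refine ⟨c • L, fun y => ?_⟩
  have h1 := hL (c • y)
  rw [← smul_sub, norm_smul, map_smul, Real.norm_eq_abs] at h1
  rw [smul_apply]
  refine h1.trans (mul_le_mul_of_nonneg_left ?_ hf.1)
  have := mul_le_of_le_one_left (norm_nonneg (y - x)) hc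
  gcongr

theorem differentiable (hf : IsC11 B C f) : Differentiable ℝ f := fun x =>
  let ⟨_, hL⟩ := hf.2.2 x
  (hasFDerivAt_of_abs_sub_le_sq hL).differentiableAt

theorem abs_sub_fderiv_le (hf : IsC11 B C f) (x y : E) :
    |f y - f x - fderiv ℝ f x (y - x)| ≤ C * ‖y - x‖ ^ 2 := by
  obtain ⟨L, hL⟩ := hf.2.2 x
  rw [(hasFDerivAt_of_abs_sub_le_sq hL).fderiv]
  exact hL y

theorem norm_fderiv_le (hf : IsC11 B C f) (x : E) : ‖fderiv ℝ f x‖ ≤ 2 * B + C := by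
  have h0 : 0 ≤ 2 * B + C := by linarith [hf.bound_nonneg, hf.1]
  have key : ∀ v : E, ‖v‖ = 1 → |fderiv ℝ f x v| ≤ 2 * B + C := by
    intro v hv
    have h1 := abs_le.1 (hf.abs_sub_fderiv_le x (x + v))
    have h2 := abs_le.1 (hf.2.1 x)
    have h3 := abs_le.1 (hf.2.1 (x + v))
    simp only [add_sub_cancel_left, hv] at h1
    rw [abs_le]; constructor <;> linarith [h1.1, h1.2, h2.1, h2.2, h3.1, h3.2]
  refine ContinuousLinearMap.opNorm_le_of_unit_norm h0 fun v hv => key v hv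

/-- With r = ‖x - y‖ and v a unit vector, the expansion at y is used at x and at x + r v, and the
one at x at x + r v. The errors are at most C r², C (2r)² and C r², whence the factor 6. -/
theorem norm_fderiv_sub_le (hf : IsC11 B C f) (x y : E) :
    ‖fderiv ℝ f x - fderiv ℝ f y‖ ≤ 6 * C * ‖x - y‖ := by
  refine ContinuousLinearMap.opNorm_le_of_unit_norm
    (mul_nonneg (by linarith [hf.1]) (norm_nonneg _)) fun v hv => ?_
  rcases eq_or_ne x y with rfl | hxy
  · simp
  have hr : 0 < ‖x - y‖ := norm_pos_iff.2 (sub_ne_zero.2 hxy)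
  set r := ‖x - y‖ with hrdef
  have hw : ‖r • v‖ = r := by rw [norm_smul, hv, mul_one, Real.norm_eq_abs, abs_of_pos hr]
  have h1 := abs_le.1 (hf.abs_sub_fderiv_le y (x + r • v))
  have h2 := abs_le.1 (hf.abs_sub_fderiv_le y x)
  have h3 := abs_le.1 (hf.abs_sub_fderiv_le x (x + r • v))
  have e : x + r • v - y = (x - y) + r • v := by abel
  rw [add_sub_cancel_left, hw] at h3
  rw [← hrdef] at h2
  have h4 : C * ‖x + r • v - y‖ ^ 2 ≤ C * (4 * r ^ 2) := by
    refine mul_le_mul_of_nonneg_left ?_ hf.1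
    have : ‖x + r • v - y‖ ≤ 2 * r := by
      rw [e]; exact (norm_add_le _ _).trans (by rw [hw]; linarith)
    nlinarith [norm_nonneg (x + r • v - y)]
  rw [e, map_add, ← e] at h1
  simp only [map_smul, smul_eq_mul] at h1 h3
  rw [sub_apply, Real.norm_eq_abs]
  have h5 : |r * (fderiv ℝ f x v - fderiv ℝ f y v)| ≤ 6 * C * r * r := by
    rw [abs_le]
    constructor <;> nlinarith [h1.1, h1.2, h2.1, h2.2, h3.1, h3.2]
  rw [abs_mul, abs_of_pos hr] at h5
  nlinarith

theorem abs_sub_le (hf : IsC11 B C f) (x y : E) : |f x - f y| ≤ (2 * B + C) * ‖x - y‖ := by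
  have := Convex.norm_image_sub_le_of_norm_fderiv_le (𝕜 := ℝ) (f := f) (s := univ)
    (fun x _ => hf.differentiable x) (fun x _ => hf.norm_fderiv_le x) convex_univ
    (mem_univ y) (mem_univ x)
  simpa using this

/-- Composition with a function of one variable. -/
theorem comp_real (hf : IsC11 B C f) {θ θ' : ℝ → ℝ} {a b : ℝ} (hb : 0 ≤ b)
    (hθ : ∀ s, |θ s| ≤ |s| + a) (hθ' : ∀ s, |θ' s| ≤ 1)
    (hq : ∀ s t, |θ t - θ s - θ' s * (t - s)| ≤ b * (t - s) ^ 2) :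
    IsC11 (B + a) (b * (2 * B + C) ^ 2 + C) (fun x => θ (f x)) := by
  refine ⟨add_nonneg (mul_nonneg hb (sq_nonneg _)) hf.1, fun x => (hθ _).trans (by
    linarith [hf.2.1 x]), fun x => ?_⟩
  obtain ⟨L, hL⟩ := hf.2.2 x
  refine ⟨θ' (f x) • L, fun y => ?_⟩
  have e : θ (f y) - θ (f x) - (θ' (f x) • L) (y - x)
      = (θ (f y) - θ (f x) - θ' (f x) * (f y - f x)) + θ' (f x) * (f y - f x - L (y - x)) := by
    rw [smul_apply, smul_eq_mul]; ring
  rw [e, add_mul]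
  refine (abs_add_le _ _).trans (add_le_add ((hq _ _).trans ?_) ?_)
  · rw [mul_assoc, ← mul_pow]
    refine mul_le_mul_of_nonneg_left ?_ hb
    rw [sq_le_sq]
    exact (hf.abs_sub_le y x).trans (le_abs_self _)
  · rw [abs_mul]
    calc |θ' (f x)| * |f y - f x - L (y - x)| ≤ 1 * (C * ‖y - x‖ ^ 2) :=
          mul_le_mul (hθ' _) (hL y) (abs_nonneg _) zero_le_one
      _ = _ := one_mul _

theorem of_contDiff_hasCompactSupport (hf : ContDiff ℝ 2 f) (hs : HasCompactSupport f) :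
    ∃ B C, IsC11 B C f := by
  obtain ⟨B, hB⟩ := hs.exists_bound_of_continuous hf.continuous
  have hf' : ContDiff ℝ 1 (fderiv ℝ f) := hf.fderiv_right (by norm_num)
  obtain ⟨C, hC⟩ := hf'.lipschitzWith_of_hasCompactSupport (hs.fderiv ℝ) (by norm_num)
  refine ⟨B, C, C.2, fun x => hB x, fun x => ⟨fderiv ℝ f x, fun y => ?_⟩⟩
  have := Convex.norm_image_sub_le_of_norm_fderiv_le' (𝕜 := ℝ) (f := f)
    (s := Metric.closedBall x ‖y - x‖) (φ := fderiv ℝ f x) (C := C * ‖y - x‖)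
    (fun z _ => hf.differentiable (by norm_num) z) (fun z hz => ?_) (convex_closedBall _ _)
    (Metric.mem_closedBall_self (norm_nonneg _)) (x := x) (y := y)
    (by rw [Metric.mem_closedBall, dist_eq_norm])
  · rw [sq, ← mul_assoc]; exact this
  · rw [← dist_eq_norm]
    refine (hC.dist_le_mul z x).trans ?_
    gcongr
    exact Metric.mem_closedBall.1 hz

end IsC11

theorem exists_isC11_cutoff [FiniteDimensional ℝ E] :
    ∃ (C : ℝ) (χ : E → ℝ), IsC11 1 C χ ∧ (∀ x, 0 ≤ χ x) ∧ (∀ x, ‖x‖ ≤ 1 → χ x = 0) ∧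
      ∀ x, 2 ≤ ‖x‖ → χ x = 1 := by
  let β : ContDiffBump (0 : E) := ⟨1, 2, by norm_num, by norm_num⟩
  obtain ⟨B, C, h⟩ := IsC11.of_contDiff_hasCompactSupport (f := β) β.contDiff β.hasCompactSupport
  have h' := h.neg.add (IsC11.const 1)
  refine ⟨C + 0, fun x => -β x + 1, ⟨h'.1, fun x => ?_, h'.2.2⟩, fun x => ?_, fun x hx => ?_,
    fun x hx => ?_⟩
  · rw [abs_le]; constructor <;> linarith [β.nonneg (x := x), β.le_one (x := x)]
  · linarith [β.le_one (x := x)]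
  · simp [β.one_of_mem_closedBall (x := x) (by simpa using hx)]
  · simp [β.zero_of_le_dist (x := x) (by simpa using hx)]

end QuadraticError

/-! ### Smooth truncation from below -/

/-- A `C^{1,1}` truncation of the identity from below: `lowerTrunc κ s = s` for `s ≥ κ` and
`lowerTrunc κ s = κ / 2` for `s ≤ 0`. -/
noncomputable def lowerTrunc (κ s : ℝ) : ℝ := s + (max (κ - s) 0 ^ 2 - max (-s) 0 ^ 2) / (2 * κ)

section LowerTrunc

variable {κ : ℝ}

theorem lowerTrunc_of_le {s : ℝ} (hκ : 0 < κ) (hs : κ ≤ s) : lowerTrunc κ s = s := by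
  rw [lowerTrunc, max_eq_right (by linarith), max_eq_right (by linarith)]; simp

theorem lowerTrunc_of_nonpos {s : ℝ} (hκ : 0 < κ) (hs : s ≤ 0) : lowerTrunc κ s = κ / 2 := by
  rw [lowerTrunc, max_eq_left (by linarith), max_eq_left (by linarith)]; field_simp; ring

theorem lowerTrunc_of_mem {s : ℝ} (hs : 0 ≤ s) (hs' : s ≤ κ) :
    lowerTrunc κ s = s + (κ - s) ^ 2 / (2 * κ) := by
  rw [lowerTrunc, max_eq_left (by linarith), max_eq_right (by linarith)]; simp

theorem le_lowerTrunc (hκ : 0 < κ) (s : ℝ) : s ≤ lowerTrunc κ s := by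
  rcases le_total s 0 with h | h
  · rw [lowerTrunc_of_nonpos hκ h]; linarith
  rcases le_total s κ with h' | h'
  · rw [lowerTrunc_of_mem h h']; linarith [show 0 ≤ (κ - s) ^ 2 / (2 * κ) by positivity]
  · rw [lowerTrunc_of_le hκ h']

theorem half_le_lowerTrunc (hκ : 0 < κ) (s : ℝ) : κ / 2 ≤ lowerTrunc κ s := by
  rcases le_total s 0 with h | h
  · rw [lowerTrunc_of_nonpos hκ h]
  rcases le_total s κ with h' | h'
  · rw [lowerTrunc_of_mem h h']
    have : s + (κ - s) ^ 2 / (2 * κ) = κ / 2 + s ^ 2 / (2 * κ) := by field_simp; ring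
    rw [this]; linarith [show 0 ≤ s ^ 2 / (2 * κ) by positivity]
  · rw [lowerTrunc_of_le hκ h']; linarith

theorem lowerTrunc_le_max (hκ : 0 < κ) (s : ℝ) : lowerTrunc κ s ≤ max s κ := by
  rcases le_total s 0 with h | h
  · rw [lowerTrunc_of_nonpos hκ h]; exact le_max_of_le_right (by linarith)
  rcases le_total s κ with h' | h'
  · rw [lowerTrunc_of_mem h h']
    refine le_max_of_le_right ?_
    have : s + (κ - s) ^ 2 / (2 * κ) = κ / 2 + s ^ 2 / (2 * κ) := by field_simp; ring
    rw [this, ← le_sub_iff_add_le', div_le_iff₀ (by linarith)]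
    nlinarith
  · rw [lowerTrunc_of_le hκ h']; exact le_max_left _ _

/-- The squared positive part is C^{1,1} with derivative 2 max(a, 0); `lowerTrunc` is the identity
plus a multiple of a difference of two such functions. -/
theorem abs_max_sq_sub_le (a b : ℝ) :
    |max b 0 ^ 2 - max a 0 ^ 2 - 2 * max a 0 * (b - a)| ≤ (b - a) ^ 2 := by
  rcases le_total a 0 with ha | ha <;> rcases le_total b 0 with hb | hb <;>
    simp only [max_eq_left, max_eq_right, ha, hb] <;> rw [abs_le] <;> constructor <;> nlinarith

theorem IsC11.lowerTrunc {E : Type*} [NormedAddCommGroup E] [NormedSpace ℝ E] {B C : ℝ} {f : E → ℝ}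
    (hf : IsC11 B C f) (hκ : 0 < κ) :
    IsC11 (B + κ) (κ⁻¹ * (2 * B + C) ^ 2 + C) (fun x => lowerTrunc κ (f x)) := by
  -- The derivative is 0 below 0, s/κ on [0, κ] and 1 above κ.
  refine hf.comp_real (θ' := fun s => 1 + (max (-s) 0 - max (κ - s) 0) / κ) (by positivity)
    (fun s => ?_) (fun s => ?_) (fun s t => ?_)
  · have h1 := le_lowerTrunc hκ s
    have h2 := lowerTrunc_le_max hκ s
    have h3 : max s κ ≤ |s| + κ := max_le (by linarith [le_abs_self s]) (by linarith [abs_nonneg s])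
    rw [abs_le]; constructor <;> linarith [neg_abs_le s]
  · have h1 : max (-s) 0 ≤ max (κ - s) 0 := max_le_max (by linarith) le_rfl
    have h2 : max (κ - s) 0 ≤ max (-s) 0 + κ :=
      max_le (by linarith [le_max_left (-s) 0]) (by linarith [le_max_right (-s) 0])
    have h3 : (max (-s) 0 - max (κ - s) 0) / κ ≤ 0 := div_nonpos_of_nonpos_of_nonneg
      (by linarith) hκ.le
    have h4 : -1 ≤ (max (-s) 0 - max (κ - s) 0) / κ := by rw [le_div_iff₀ hκ]; linarith
    rw [abs_le]; constructor <;> linarith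
  · have h1 := abs_le.1 (abs_max_sq_sub_le (κ - s) (κ - t))
    have h2 := abs_le.1 (abs_max_sq_sub_le (-s) (-t))
    have e : _root_.lowerTrunc κ t - _root_.lowerTrunc κ s
          - (1 + (max (-s) 0 - max (κ - s) 0) / κ) * (t - s)
        = κ⁻¹ * (((max (κ - t) 0 ^ 2 - max (κ - s) 0 ^ 2
            - 2 * max (κ - s) 0 * ((κ - t) - (κ - s)))
          - (max (-t) 0 ^ 2 - max (-s) 0 ^ 2 - 2 * max (-s) 0 * (-t - -s))) / 2) := by
      simp only [_root_.lowerTrunc]; field_simp; ring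
    rw [e, abs_mul, abs_of_pos (inv_pos.2 hκ)]
    refine mul_le_mul_of_nonneg_left ?_ (inv_pos.2 hκ).le
    rw [abs_le]; constructor <;> nlinarith [h1.1, h1.2, h2.1, h2.2]

end LowerTrunc

/-! ### Convex minorants and C^{1,1} interposition -/

section Interposition

variable {E : Type*}

/-- Hahn–Banach separates (x, p x) from the open strict epigraph. The vertical coefficient c of the
separating functional is negative, so dividing by -c yields the slope. -/
theorem ConvexOn.exists_subgradient [NormedAddCommGroup E] [NormedSpace ℝ E]
    [FiniteDimensional ℝ E] {p : E → ℝ} (hp : ConvexOn ℝ univ p) (x : E) :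
    ∃ L : E →L[ℝ] ℝ, ∀ y, p x + L (y - x) ≤ p y := by
  have hc : Continuous p := hp.locallyLipschitz.continuous
  have hconv : Convex ℝ {z : E × ℝ | p z.1 < z.2} := by
    simpa using hp.convex_strict_epigraph
  have hopen : IsOpen {z : E × ℝ | p z.1 < z.2} :=
    isOpen_lt (hc.comp continuous_fst) continuous_snd
  obtain ⟨ℓ, hℓ⟩ := geometric_hahn_banach_open_point hconv hopen (x := (x, p x)) (by simp)
  have hsplit : ∀ (y : E) (r : ℝ), ℓ (y, r) = ℓ (y, 0) + r * ℓ (0, 1) := fun y r => by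
    have : ((y, r) : E × ℝ) = (y, 0) + r • (0, 1) := by simp
    rw [this, map_add, map_smul, smul_eq_mul]
  set c := ℓ (0, 1) with hcdef
  have hcneg : c < 0 := by
    have := hℓ (x, p x + 1) (by simp)
    rw [hsplit x (p x + 1), hsplit x (p x)] at this
    linarith
  have hle : ∀ y, ℓ (y, 0) + p y * c ≤ ℓ (x, 0) + p x * c := fun y => by
    refine le_of_forall_pos_lt_add fun ε hε => ?_
    have := hℓ (y, p y + ε / (-c)) (by simpa using div_pos hε (neg_pos.2 hcneg))
    rw [hsplit y, hsplit x (p x)] at this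
    have e : ε / (-c) * c = -ε := by rw [div_neg, neg_mul, div_mul_cancel₀ _ hcneg.ne]
    rw [add_mul, e] at this
    linarith
  refine ⟨(-c⁻¹) • (ℓ.comp (ContinuousLinearMap.inl ℝ E ℝ)), fun y => ?_⟩
  have h1 := hle y
  have h2 : ℓ (y - x, (0 : ℝ)) = ℓ (y, 0) - ℓ (x, 0) := by rw [← map_sub]; simp
  simp only [smul_apply, ContinuousLinearMap.comp_apply, ContinuousLinearMap.inl_apply,
    smul_eq_mul, h2]
  have h3 : (ℓ (y, 0) - ℓ (x, 0)) ≤ (p x - p y) * c := by linarith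
  have h4 : 0 ≤ (-c⁻¹) := by simpa using (inv_neg''.2 hcneg).le
  have h5 := mul_le_mul_of_nonneg_left h3 h4
  have h6 : -c⁻¹ * ((p x - p y) * c) = p y - p x := by
    field_simp [hcneg.ne]; ring
  linarith

/-- Convexity gives the lower bound through a subgradient; the subgradient inequality at the
reflected point 2x - y, inserted in the second difference, gives the upper one. -/
theorem ConvexOn.exists_abs_sub_le_sq [NormedAddCommGroup E] [NormedSpace ℝ E]
    [FiniteDimensional ℝ E] {p : E → ℝ} (hp : ConvexOn ℝ univ p) {C : ℝ}
    (hC : ∀ x k, p (x + k) + p (x - k) - 2 * p x ≤ C * ‖k‖ ^ 2) (x : E) :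
    ∃ L : E →L[ℝ] ℝ, ∀ y, 0 ≤ p y - p x - L (y - x) ∧ p y - p x - L (y - x) ≤ C * ‖y - x‖ ^ 2 := by
  obtain ⟨L, hL⟩ := hp.exists_subgradient x
  refine ⟨L, fun y => ⟨by linarith [hL y], ?_⟩⟩
  have h1 := hC x (y - x)
  have h2 := hL (x - (y - x))
  rw [add_sub_cancel] at h1
  rw [sub_sub_cancel_left, map_neg] at h2
  linarith

/-- The largest convex minorant of a function with convex minorants inherits an upper bound on
the second differences. -/
theorem exists_convexOn_between [NormedAddCommGroup E] [NormedSpace ℝ E] {ι : Type*}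
    {a : ι → E → ℝ} {W : E → ℝ} {C : ℝ} (i₀ : ι) (ha : ∀ i, ConvexOn ℝ univ (a i))
    (haW : ∀ i x, a i x ≤ W x)
    (hW : ∀ x k, W (x + k) + W (x - k) - 2 * W x ≤ C * ‖k‖ ^ 2) :
    ∃ p : E → ℝ, ConvexOn ℝ univ p ∧ (∀ i x, a i x ≤ p x) ∧ (∀ x, p x ≤ W x) ∧
      ∀ x k, p (x + k) + p (x - k) - 2 * p x ≤ C * ‖k‖ ^ 2 := by
  let S : Type _ := {c : E → ℝ // ConvexOn ℝ univ c ∧ ∀ x, c x ≤ W x}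
  have : Nonempty S := ⟨⟨a i₀, ha i₀, haW i₀⟩⟩
  let p : E → ℝ := fun x => ⨆ c : S, c.1 x
  have hbdd : ∀ x, BddAbove (range fun c : S => c.1 x) := fun x =>
    ⟨W x, by rintro _ ⟨c, rfl⟩; exact c.2.2 x⟩
  have hle : ∀ (c : S) x, c.1 x ≤ p x := fun c x => le_ciSup (hbdd x) c
  have hp : ConvexOn ℝ univ p := by
    refine ⟨convex_univ, fun x _ y _ s t hs ht hst => ciSup_le fun c => ?_⟩
    refine (c.2.1.2 (mem_univ x) (mem_univ y) hs ht hst).trans ?_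
    have h1 := hle c x
    have h2 := hle c y
    simp only [smul_eq_mul]
    gcongr
  refine ⟨p, hp, fun i x => hle ⟨a i, ha i, haW i⟩ x, fun x => ciSup_le fun c => c.2.2 x,
    fun x k => ?_⟩
  have hshift : ∀ v : E, ConvexOn ℝ univ fun y => p (y + v) := fun v => by
    simpa [Function.comp_def] using hp.translate_left v
  have hpW : ∀ x, p x ≤ W x := fun x => ciSup_le fun c => c.2.2 x
  -- Averaging two translates of p and subtracting C‖k‖²/2 gives another convex minorant of W.
  -- Maximality of p at x is then the second difference bound.
  let c : S := ⟨fun y => (1 / 2 : ℝ) • (p (y + k) + p (y + -k)) + (-(C * ‖k‖ ^ 2 / 2)),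
    (((hshift k).add (hshift (-k))).smul (by norm_num)).add_const _, fun y => by
      have h1 := hpW (y + k)
      have h2 := hpW (y + -k)
      have h3 := hW y k
      rw [sub_eq_add_neg y k] at h3
      simp only [smul_eq_mul]
      linarith⟩
  have := hle c x
  simp only [c, smul_eq_mul, ← sub_eq_add_neg] at this
  linarith

/-- Interposition: if `U i - V j ≤ 2 K ⟪ξ, z i - w j⟫ + K ‖z i - w j‖²` for all `i, j`, there is a
function with quadratic first order error, above all `U i` at `z i` and below all `V j` at `w j`. -/
theorem exists_interposition [NormedAddCommGroup E] [InnerProductSpace ℝ E]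
    [FiniteDimensional ℝ E] {ι κ : Type*} [Nonempty ι] [Nonempty κ] {K : ℝ} (hK : 0 ≤ K)
    (ξ : E) (z : ι → E) (U : ι → ℝ) (w : κ → E) (V : κ → ℝ)
    (h : ∀ i j, U i - V j ≤ 2 * K * inner ℝ ξ (z i - w j) + K * ‖z i - w j‖ ^ 2) :
    ∃ g : E → ℝ, (∀ i, U i ≤ g (z i)) ∧ (∀ j, g (w j) ≤ V j) ∧
      ∀ x, ∃ L : E →L[ℝ] ℝ, ∀ y, |g y - g x - L (y - x)| ≤ 8 * K * ‖y - x‖ ^ 2 := by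
  let ℓ : E →L[ℝ] ℝ := (2 * K) • innerSL ℝ ξ
  have hℓ : ∀ v, ℓ v = 2 * K * inner ℝ ξ v := fun v => by simp [ℓ]
  let U' : ι → ℝ := fun i => U i - ℓ (z i)
  let V' : κ → ℝ := fun j => V j - ℓ (w j)
  have h' : ∀ i j, U' i - V' j ≤ K * ‖z i - w j‖ ^ 2 := fun i j => by
    have := h i j
    rw [← hℓ, map_sub] at this
    simp only [U', V']; linarith
  -- After the linear part is removed, U' i - 2K‖z i - q‖² lies below V' j + 2K‖q - w j‖². Adding
  -- 2K‖q‖² to both makes the lower family affine in q, so a convex function fits between.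
  let a : ι → E → ℝ := fun i q => U' i - 2 * K * ‖z i‖ ^ 2 + (4 * K) * inner ℝ (z i) q
  let b : κ → E → ℝ := fun j q => V' j + 2 * K * ‖q - w j‖ ^ 2 + 2 * K * ‖q‖ ^ 2
  have ha_eq : ∀ i q, a i q = U' i - 2 * K * ‖z i - q‖ ^ 2 + 2 * K * ‖q‖ ^ 2 := fun i q => by
    rw [norm_sub_sq_real]; simp only [a]; ring
  have hab : ∀ i j q, a i q ≤ b j q := fun i j q => by
    rw [ha_eq]
    have h1 := h' i j
    have h2 : ‖z i - w j‖ ^ 2 ≤ 2 * ‖z i - q‖ ^ 2 + 2 * ‖q - w j‖ ^ 2 := by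
      have e : z i - w j = (z i - q) + (q - w j) := by abel
      have := norm_add_le (z i - q) (q - w j)
      rw [← e] at this
      nlinarith [norm_nonneg (z i - w j), sq_nonneg (‖z i - q‖ - ‖q - w j‖)]
    have h3 := mul_le_mul_of_nonneg_left h2 hK
    simp only [b]
    linarith
  let W : E → ℝ := fun q => ⨅ j, b j q
  obtain ⟨i₀⟩ := ‹Nonempty ι›
  have hbdd : ∀ q, BddBelow (range fun j => b j q) := fun q =>
    ⟨a i₀ q, by rintro _ ⟨j, rfl⟩; exact hab i₀ j q⟩
  have hWb : ∀ j q, W q ≤ b j q := fun j q => ciInf_le (hbdd q) j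
  -- Each b j has second difference exactly 8K‖k‖², and an infimum preserves the upper bound.
  have hW : ∀ x k, W (x + k) + W (x - k) - 2 * W x ≤ 8 * K * ‖k‖ ^ 2 := fun x k => by
    have h1 : (W (x + k) + W (x - k) - 8 * K * ‖k‖ ^ 2) / 2 ≤ W x := by
      refine le_ciInf fun j => ?_
      have h2 := hWb j (x + k)
      have h3 := hWb j (x - k)
      have e1 : x + k - w j = (x - w j) + k := by abel
      have e2 : x - k - w j = (x - w j) - k := by abel
      simp only [b, e1, e2, norm_add_sq_real, norm_sub_sq_real (x - w j) k,
        norm_sub_sq_real x k] at h2 h3 ⊢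
      linarith
    linarith
  have ha : ∀ i, ConvexOn ℝ univ (a i) := fun i => by
    refine ⟨convex_univ, fun x _ y _ s t _ _ hst => le_of_eq ?_⟩
    simp only [a, inner_add_right, inner_smul_right, smul_eq_mul]
    have : t = 1 - s := by linarith
    subst this; ring
  obtain ⟨p, hp, hap, hpW, hp2⟩ :=
    exists_convexOn_between i₀ ha (fun i q => le_ciInf fun j => hab i j q) hW
  refine ⟨fun q => p q - 2 * K * ‖q‖ ^ 2 + ℓ q, fun i => ?_, fun j => ?_, fun x => ?_⟩
  · have := hap i (z i)
    rw [ha_eq] at this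
    simp only [sub_self, norm_zero, U'] at this ⊢
    linarith
  · have := (hpW (w j)).trans (hWb j (w j))
    simp only [b, sub_self, norm_zero, V'] at this ⊢
    linarith
  · obtain ⟨L, hL⟩ := hp.exists_abs_sub_le_sq hp2 x
    refine ⟨L - (4 * K) • innerSL ℝ x + ℓ, fun y => ?_⟩
    obtain ⟨h1, h2⟩ := hL y
    have e : p y - 2 * K * ‖y‖ ^ 2 + ℓ y - (p x - 2 * K * ‖x‖ ^ 2 + ℓ x)
        - (L - (4 * K) • innerSL ℝ x + ℓ) (y - x)
        = (p y - p x - L (y - x)) - 2 * K * ‖y - x‖ ^ 2 := by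
      simp only [add_apply, sub_apply, smul_apply, innerSL_apply_apply, smul_eq_mul, map_sub,
        real_inner_self_eq_norm_sq, norm_sub_sq_real, real_inner_comm x y]
      ring
    rw [e, abs_le]
    have h3 : 0 ≤ K * ‖y - x‖ ^ 2 := by positivity
    constructor <;> linarith

end Interposition

/-! ### From quadratic error bounds to Hölder norms and test functions -/

section HolderNorms

variable {d : ℕ} {γ : ℝ≥0}

theorem supENorm_le_ofReal {F : Type*} [NormedAddCommGroup F] {s : Set (EuclideanSpace ℝ (Fin d))}
    {f : EuclideanSpace ℝ (Fin d) → F} {B : ℝ} (h : ∀ x ∈ s, ‖f x‖ ≤ B) :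
    supENorm s f ≤ ENNReal.ofReal B :=
  iSup₂_le fun x hx => by
    rw [← ofReal_norm]; exact ENNReal.ofReal_le_ofReal (h x hx)

/-- At distances at most 1 the Lipschitz bound is stronger than the Hölder one; at larger distances
the sup bound suffices. -/
theorem eHolderNorm_univ_le {F : Type*} [NormedAddCommGroup F] (hγ : γ ≤ 1)
    {f : EuclideanSpace ℝ (Fin d) → F} {B L : ℝ} (hB : ∀ x, ‖f x‖ ≤ B) (hL0 : 0 ≤ L)
    (hL : ∀ x y, ‖f x - f y‖ ≤ L * ‖x - y‖) :
    eHolderNorm γ ((univ : Set (EuclideanSpace ℝ (Fin d))).domRestrict f)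
      ≤ ENNReal.ofReal (L + 2 * B) := by
  have hB0 : 0 ≤ B := (norm_nonneg _).trans (hB 0)
  have h : HolderWith (Real.toNNReal (L + 2 * B)) γ
      ((univ : Set (EuclideanSpace ℝ (Fin d))).domRestrict f) := by
    intro x y
    rw [edist_dist, edist_dist, ENNReal.ofReal_rpow_of_nonneg dist_nonneg (NNReal.coe_nonneg γ)]
    change _ ≤ ENNReal.ofReal (L + 2 * B) * _
    rw [← ENNReal.ofReal_mul (by positivity)]
    refine ENNReal.ofReal_le_ofReal ?_
    have h1 : dist (x : EuclideanSpace ℝ (Fin d)) y = ‖(x : EuclideanSpace ℝ (Fin d)) - y‖ :=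
      dist_eq_norm _ _
    rw [Subtype.dist_eq, h1, dist_eq_norm]
    set r := ‖(x : EuclideanSpace ℝ (Fin d)) - y‖ with hr
    have hr0 : 0 ≤ r := norm_nonneg _
    change ‖f x - f y‖ ≤ (L + 2 * B) * r ^ (γ : ℝ)
    rcases le_total r 1 with h | h
    · have h2 : r ≤ r ^ (γ : ℝ) := by
        rcases hr0.eq_or_lt with h0 | h0
        · rw [← h0]; exact Real.rpow_nonneg le_rfl _
        · simpa using Real.rpow_le_rpow_of_exponent_ge h0 h (by exact_mod_cast hγ : (γ : ℝ) ≤ 1)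
      calc ‖f x - f y‖ ≤ L * r := hL _ _
        _ ≤ (L + 2 * B) * r ^ (γ : ℝ) :=
          mul_le_mul (by linarith) h2 hr0 (by positivity)
    · have h2 : 1 ≤ r ^ (γ : ℝ) := Real.one_le_rpow h γ.2
      calc ‖f x - f y‖ ≤ ‖f x‖ + ‖f y‖ := norm_sub_le _ _
        _ ≤ (L + 2 * B) * 1 := by linarith [hB x, hB y]
        _ ≤ _ := mul_le_mul_of_nonneg_left h2 (by positivity)
  exact h.eHolderNorm_le

namespace IsC11

variable {B C : ℝ} {f g : EuclideanSpace ℝ (Fin d) → ℝ}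

theorem c1HolderENorm_le (hf : IsC11 B C f) (hγ : γ ≤ 1) :
    c1HolderENorm γ univ f ≤ ENNReal.ofReal (11 * B + 10 * C) := by
  have hB := hf.bound_nonneg
  have hC := hf.1
  have h1 : supENorm univ f ≤ ENNReal.ofReal B := supENorm_le_ofReal fun x _ => hf.2.1 x
  have h2 := eHolderNorm_univ_le (γ := γ) hγ (f := f) (fun x => hf.2.1 x) (L := 2 * B + C) (by positivity)
    (fun x y => hf.abs_sub_le x y)
  have h3 : supENorm univ (fderiv ℝ f) ≤ ENNReal.ofReal (2 * B + C) :=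
    supENorm_le_ofReal fun x _ => hf.norm_fderiv_le x
  have h4 := eHolderNorm_univ_le (γ := γ) hγ hf.norm_fderiv_le (L := 6 * C) (by positivity)
    hf.norm_fderiv_sub_le
  refine (add_le_add (add_le_add (add_le_add h1 h2) h3) h4).trans ?_
  rw [← ENNReal.ofReal_add (by positivity) (by positivity),
    ← ENNReal.ofReal_add (by positivity) (by positivity),
    ← ENNReal.ofReal_add (by positivity) (by positivity)]
  exact ENNReal.ofReal_le_ofReal (by linarith)

theorem isC1Holder (hf : IsC11 B C f) (hγ : γ ≤ 1) : IsC1Holder γ f :=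
  ⟨hf.differentiable, (hf.c1HolderENorm_le hγ).trans_lt ENNReal.ofReal_lt_top⟩

theorem mem_classK (hf : IsC11 B C f) (hγ : γ ≤ 1) {δ m : ℝ} (hδ : ∀ x, δ ≤ f x)
    (hm : 11 * B + 10 * C ≤ m) : f ∈ classK d γ δ m :=
  ⟨hf.isC1Holder hγ, hδ, (hf.c1HolderENorm_le hγ).trans (ENNReal.ofReal_le_ofReal hm)⟩

/-- Test functions that split into a space part and a time part. -/
theorem isTestFunction (hf : IsC11 B C f) (hγ : γ < 1) {b : ℝ → ℝ} (hb : ContDiff ℝ 1 b) :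
    IsTestFunction γ (fun y s => f y + b s) := by
  refine ⟨(1 - γ) / 2, by simpa using hγ, ?_, fun s => ?_, fun y => contDiff_const.add hb⟩
  · rw [← NNReal.coe_lt_coe]
    have : (γ : ℝ) < 1 := by exact_mod_cast hγ
    push_cast [NNReal.coe_sub hγ.le]; linarith
  · refine (hf.add (IsC11.const (b s))).isC1Holder ?_
    rw [← NNReal.coe_le_coe]
    have : (γ : ℝ) < 1 := by exact_mod_cast hγ
    push_cast [NNReal.coe_sub hγ.le]; linarith

end IsC11

theorem mem_domK {δ m : ℝ} (hδ : 0 < δ) (hm : δ < m) {f : EuclideanSpace ℝ (Fin d) → ℝ}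
    (hf : f ∈ classK d γ δ m) : f ∈ domK d γ :=
  mem_iUnion₂.2 ⟨δ, hδ, mem_iUnion₂.2 ⟨m, hm, hf⟩⟩

theorem c1HolderENorm_eq_zero {s : Set (EuclideanSpace ℝ (Fin d))} (hs : IsOpen s)
    {f : EuclideanSpace ℝ (Fin d) → ℝ} (hf : ∀ x ∈ s, f x = 0) : c1HolderENorm γ s f = 0 := by
  have hf' : ∀ x ∈ s, fderiv ℝ f x = 0 := fun x hx => by
    have : f =ᶠ[𝓝 x] fun _ => 0 := by
      filter_upwards [hs.mem_nhds hx] with y hy using hf y hy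
    rw [this.fderiv_eq]; simp
  have e1 : s.domRestrict f = 0 := funext fun x => hf x x.2
  have e2 : s.domRestrict (fderiv ℝ f) = 0 := funext fun x => hf' x x.2
  have e3 : supENorm s f = 0 := by
    rw [supENorm, ← bot_eq_zero]
    exact iSup₂_eq_bot.2 fun x hx => by simp [hf x hx]
  have e4 : supENorm s (fderiv ℝ f) = 0 := by
    rw [supENorm, ← bot_eq_zero]
    exact iSup₂_eq_bot.2 fun x hx => by simp [hf' x hx]
  rw [c1HolderENorm, e1, e2, e3, e4]
  simp

theorem abs_le_of_supENorm_le {s : Set (EuclideanSpace ℝ (Fin d))}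
    {f : EuclideanSpace ℝ (Fin d) → ℝ} {B : ℝ} (hB : 0 ≤ B)
    (h : supENorm s f ≤ ENNReal.ofReal B) {x : EuclideanSpace ℝ (Fin d)} (hx : x ∈ s) :
    |f x| ≤ B := by
  have h1 : ‖f x‖ₑ ≤ ENNReal.ofReal B := (le_iSup₂ (f := fun x _ => ‖f x‖ₑ) x hx).trans h
  rwa [← ofReal_norm, ENNReal.ofReal_le_ofReal_iff hB] at h1

end HolderNorms

/-! ### Quantitative continuity of J -/

namespace IsNonlocalOperator

variable {d : ℕ} {γ : ℝ≥0} {J : (EuclideanSpace ℝ (Fin d) → ℝ) → EuclideanSpace ℝ (Fin d) → ℝ}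

theorem exists_abs_sub_le (hJ : IsNonlocalOperator γ J) {δ m : ℝ} (hδ : 0 < δ) (hm : δ < m) :
    ∃ A : ℝ, 0 ≤ A ∧ ∀ f ∈ classK d γ δ m, ∀ g ∈ classK d γ δ m, ∀ B C : ℝ,
      IsC11 B C (f - g) → ∀ x, |J f x - J g x| ≤ A * (11 * B + 10 * C) := by
  obtain ⟨K, -, hK⟩ := hJ.lipschitz
  refine ⟨K δ m, NNReal.coe_nonneg _, fun f hf g hg B C h x => ?_⟩
  have h1 := hK δ m hδ hm f hf g hg
  have hnn : 0 ≤ 11 * B + 10 * C := by linarith [h.bound_nonneg, h.1]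
  have h2 : supENorm univ (J f - J g) ≤ ENNReal.ofReal (K δ m * (11 * B + 10 * C)) := by
    refine h1.trans ?_
    rw [ENNReal.ofReal_mul (NNReal.coe_nonneg _), ENNReal.ofReal_coe_nnreal]
    gcongr
    exact h.c1HolderENorm_le hJ.gamma_lt_one.le
  exact abs_le_of_supENorm_le (mul_nonneg (NNReal.coe_nonneg _) hnn) h2 (mem_univ x)

/-- The local norm in the splitting property vanishes, leaving C ρ(R)(D + 1), which is small for
large R. The radius depends on δ, m, D and ε only, not on the two functions. -/
theorem exists_abs_sub_le_of_eqOn_ball (hJ : IsNonlocalOperator γ J) {δ m : ℝ} (hδ : 0 < δ)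
    (hm : δ < m) {D ε : ℝ} (hD : 0 ≤ D) (hε : 0 < ε) :
    ∃ R : ℝ, 1 < R ∧ ∀ f ∈ classK d γ δ m, ∀ g ∈ classK d γ δ m,
      (∀ x, ‖x‖ < 2 * R → f x = g x) → (∀ x, |f x - g x| ≤ D) → |J f 0 - J g 0| ≤ ε := by
  obtain ⟨C, ρ, hρ, h⟩ := hJ.splitting δ m hδ hm
  have hlim : Tendsto (fun R => (C : ℝ) * (ρ R * D + ρ R)) atTop (𝓝 0) := by
    have h1 : Tendsto (fun R => (ρ R : ℝ)) atTop (𝓝 0) := by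
      simpa using NNReal.tendsto_coe.2 hρ
    simpa using ((h1.mul_const D).add h1).const_mul (C : ℝ)
  obtain ⟨R, hRε, hR⟩ := ((hlim.eventually (ge_mem_nhds hε)).and (eventually_gt_atTop 1)).exists
  refine ⟨R, hR, fun f hf g hg heq hle => ?_⟩
  have h1 := h f hf g hg R hR
  rw [c1HolderENorm_eq_zero Metric.isOpen_ball (f := f - g) (fun x hx => by
    simpa [sub_eq_zero] using heq x (by simpa using hx)), zero_add] at h1
  have h2 : supENorm univ (f - g) ≤ ENNReal.ofReal D := supENorm_le_ofReal fun x _ => hle x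
  refine (abs_le_of_supENorm_le (f := J f - J g) (by positivity) (h1.trans ?_)
    (Metric.mem_ball_self (by linarith))).trans hRε
  rw [ENNReal.ofReal_mul (by positivity), ENNReal.ofReal_add (by positivity) (by positivity),
    ENNReal.ofReal_mul (by positivity), ENNReal.ofReal_coe_nnreal, ENNReal.ofReal_coe_nnreal]
  gcongr

end IsNonlocalOperator

/-! ### Truncated test functions and the doubled maximum -/

/-- Testing a supersolution with a function that need not be positive: the test function is
truncated from below. -/
theorem IsViscositySupersolution.lowerTrunc_le {d : ℕ} {γ : ℝ≥0}
    {J : (EuclideanSpace ℝ (Fin d) → ℝ) → EuclideanSpace ℝ (Fin d) → ℝ} {T : ℝ}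
    {f : EuclideanSpace ℝ (Fin d) → ℝ → ℝ} (hf : IsViscositySupersolution γ J T f) (hγ : γ < 1)
    {δ : ℝ} (hδ : 0 < δ) (hfδ : ∀ x, ∀ t ∈ Icc 0 T, δ ≤ f x t)
    {B C : ℝ} {ψ : EuclideanSpace ℝ (Fin d) → ℝ} (hψ : IsC11 B C ψ) {b : ℝ → ℝ}
    (hb : ContDiff ℝ 1 b) {x : EuclideanSpace ℝ (Fin d)} {t : ℝ} (ht : t ∈ Ioc 0 T)
    (hbt : b t = 0) (hxt : ψ x = f x t) (hle : ∀ y, ∀ s ∈ Icc 0 T, ψ y + b s ≤ f y s) :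
    J (fun y => lowerTrunc (δ / 2) (ψ y)) x ≤ deriv b t := by
  have hδ2 : 0 < δ / 2 := by linarith
  have hcont : ∀ᶠ s in 𝓝 t, |b s| < δ / 8 := by
    have : Tendsto (fun s => |b s|) (𝓝 t) (𝓝 0) := by
      simpa [hbt] using (hb.continuous.abs.tendsto t)
    exact this.eventually (gt_mem_nhds (by linarith))
  obtain ⟨r₀, hr₀, hball⟩ := Metric.eventually_nhds_iff.1 hcont
  have ht0 : 0 < t := ht.1
  -- On this time window |b| < δ/8. The truncated test function is therefore at least δ/4 - δ/8, and
  -- where truncation acts it stays below δ/2 + δ/8 < δ ≤ f; at the contact point it is unchanged.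
  let r := min r₀ t / 2
  have hm : 0 < min r₀ t := lt_min hr₀ ht0
  have hr : 0 < r := by positivity
  have hrt : r < t := by simp only [r]; linarith [min_le_right r₀ t]
  have hs : ∀ s ∈ Ioc (t - r) t, s ∈ Icc 0 T ∧ |b s| < δ / 8 := fun s hs => by
    refine ⟨⟨by linarith [hs.1], hs.2.trans ht.2⟩, hball ?_⟩
    rw [Real.dist_eq, abs_lt]
    constructor <;> simp only [r] at hs <;> linarith [hs.1, hs.2, min_le_left r₀ t]
  have key := hf.2.2 x t ht (fun y s => lowerTrunc (δ / 2) (ψ y) + b s)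
    ((hψ.lowerTrunc hδ2).isTestFunction hγ hb) r hr hrt
    ⟨δ / 8, by linarith, fun y s hst => ?_⟩ ?_ fun y s hst => ?_
  · simpa [hbt] using key
  · have := half_le_lowerTrunc hδ2 (ψ y)
    linarith [(abs_lt.1 (hs s hst).2).1]
  · rw [hbt, add_zero, lowerTrunc_of_le hδ2 (by rw [hxt]; linarith [hfδ x t ⟨ht.1.le, ht.2⟩]), hxt]
  · obtain ⟨h1, h2⟩ := hs s hst
    rw [← le_sub_iff_add_le]
    refine (lowerTrunc_le_max hδ2 _).trans (max_le ?_ ?_)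
    · linarith [hle y s h1]
    · linarith [hfδ y s h1, (abs_lt.1 h2).2]

/-- The doubling of variables functional attains its maximum at positive times, near a given almost
maximum point of the functional with a single time variable. -/
theorem exists_doubling_max {E : Type*} [NormedAddCommGroup E] [ProperSpace E] {f : E → ℝ → ℝ}
    {T M K l N α ρ t₀ : ℝ} {h x₀ y₀ : E} {P Q : E → ℝ}
    (hf : ContinuousOn (Function.uncurry f) (univ ×ˢ Icc 0 T))
    (hf0 : ∀ x, ∀ t ∈ Icc 0 T, 0 ≤ f x t) (hfM : ∀ x, ∀ t ∈ Icc 0 T, f x t ≤ M)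
    (hM : 0 ≤ M) (hK : 0 ≤ K) (hl : 0 ≤ l) (hα : 0 < α) (hNα : 0 < N - α) (hρ : 0 ≤ ρ)
    (hN : ∀ x y, ∀ t ∈ Icc 0 T, f x t - f y t - K * ‖x - y - h‖ ^ 2 - l * t ≤ N)
    (ht₀ : t₀ ∈ Icc 0 T)
    (h₀ : N - α < f x₀ t₀ - f y₀ t₀ - K * ‖x₀ - y₀ - h‖ ^ 2 - l * t₀)
    (hinit : ∀ x y, f x 0 - f y 0 - K * ‖x - y - h‖ ^ 2 ≤ N - 2 * α)
    (hPc : Continuous P) (hQc : Continuous Q) (hP : ∀ x, 0 ≤ P x) (hQ : ∀ x, 0 ≤ Q x)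
    (hPx : P x₀ = 0) (hQy : Q y₀ = 0)
    (hP2 : ∀ x, 2 ≤ ‖x - x₀‖ → 2 * α ≤ P x) (hQ2 : ∀ x, 2 ≤ ‖x - y₀‖ → 2 * α ≤ Q x)
    (hPM : ∀ x, ρ ≤ ‖x - x₀‖ → M ≤ P x) (hQM : ∀ x, ρ ≤ ‖x - y₀‖ → M ≤ Q x) :
    ∃ H : ℝ, 0 ≤ H ∧ ∃ x₁ y₁ : E, ∃ t₁ ∈ Ioc 0 T, ∃ s₁ ∈ Ioc 0 T,
      ‖x₁ - x₀‖ < 2 ∧ ‖y₁ - y₀‖ < 2 ∧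
      0 < f x₁ t₁ - f y₁ s₁ - K * ‖x₁ - y₁ - h‖ ^ 2 - H * (t₁ - s₁) ^ 2 - l * t₁ - P x₁ - Q y₁ ∧
      ∀ x y, ∀ t ∈ Icc 0 T, ∀ s ∈ Icc 0 T,
        f x t - f y s - K * ‖x - y - h‖ ^ 2 - H * (t - s) ^ 2 - l * t - P x - Q y ≤
        f x₁ t₁ - f y₁ s₁ - K * ‖x₁ - y₁ - h‖ ^ 2 - H * (t₁ - s₁) ^ 2 - l * t₁ - P x₁ - Q y₁ := by
  have hT : 0 ≤ T := ht₀.1.trans ht₀.2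
  have hS : IsCompact ((Metric.closedBall x₀ ρ ∪ Metric.closedBall y₀ ρ) ×ˢ Icc 0 T) :=
    ((isCompact_closedBall _ _).union (isCompact_closedBall _ _)).prod isCompact_Icc
  have hunif := Metric.uniformContinuousOn_iff.1
    (hS.uniformContinuousOn_of_continuous (hf.mono (prod_mono (subset_univ _) le_rfl)))
    (α / 2) (by linarith)
  obtain ⟨τ, hτ, hunif⟩ := hunif
  -- The maximum value is positive, which forces H(t₁ - s₁)² ≤ M and hence |t₁ - s₁| < τ. Equalizing
  -- the two times then costs less than α/2.
  let H : ℝ := (M + 1) / τ ^ 2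
  have hH : 0 ≤ H := by positivity
  let Φ : (E × E) × (ℝ × ℝ) → ℝ := fun z =>
    f z.1.1 z.2.1 - f z.1.2 z.2.2 - K * ‖z.1.1 - z.1.2 - h‖ ^ 2 - H * (z.2.1 - z.2.2) ^ 2
      - l * z.2.1 - P z.1.1 - Q z.1.2
  let D : Set ((E × E) × (ℝ × ℝ)) :=
    (Metric.closedBall x₀ ρ ×ˢ Metric.closedBall y₀ ρ) ×ˢ (Icc 0 T ×ˢ Icc 0 T)
  have hD : IsCompact D := ((isCompact_closedBall _ _).prod (isCompact_closedBall _ _)).prod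
    (isCompact_Icc.prod isCompact_Icc)
  have hΦ : ContinuousOn Φ D := by
    have h1 : ContinuousOn (fun z : (E × E) × (ℝ × ℝ) => f z.1.1 z.2.1) D :=
      hf.comp (f := fun z : (E × E) × (ℝ × ℝ) => (z.1.1, z.2.1))
        (by fun_prop) fun z hz => ⟨mem_univ _, hz.2.1⟩
    have h2 : ContinuousOn (fun z : (E × E) × (ℝ × ℝ) => f z.1.2 z.2.2) D :=
      hf.comp (f := fun z : (E × E) × (ℝ × ℝ) => (z.1.2, z.2.2))
        (by fun_prop) fun z hz => ⟨mem_univ _, hz.2.2⟩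
    have h3 : Continuous fun z : (E × E) × (ℝ × ℝ) => K * ‖z.1.1 - z.1.2 - h‖ ^ 2
      + H * (z.2.1 - z.2.2) ^ 2 + l * z.2.1 + P z.1.1 + Q z.1.2 := by fun_prop
    refine ((h1.sub h2).sub h3.continuousOn).congr fun z _ => ?_
    simp only [Φ, Pi.sub_apply]; ring
  have hz₀ : ((x₀, y₀), (t₀, t₀)) ∈ D :=
    ⟨⟨Metric.mem_closedBall_self hρ, Metric.mem_closedBall_self hρ⟩, ht₀, ht₀⟩
  obtain ⟨⟨⟨x₁, y₁⟩, ⟨t₁, s₁⟩⟩, hz₁, hmax⟩ := hD.exists_isMaxOn ⟨_, hz₀⟩ hΦ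
  obtain ⟨⟨hx₁, hy₁⟩, ht₁, hs₁⟩ := hz₁
  simp only at hx₁ hy₁ ht₁ hs₁
  have hval : N - α < Φ ((x₁, y₁), (t₁, s₁)) := by
    refine lt_of_lt_of_le ?_ (hmax hz₀)
    simp only [Φ, hPx, hQy, sub_self]
    linarith
  have hval' := hval
  simp only [Φ] at hval'
  have hKn : 0 ≤ K * ‖x₁ - y₁ - h‖ ^ 2 := by positivity
  have hHn : 0 ≤ H * (t₁ - s₁) ^ 2 := by positivity
  have hltn : 0 ≤ l * t₁ := mul_nonneg hl ht₁.1
  have hts : |t₁ - s₁| < τ := by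
    have h1 : H * (t₁ - s₁) ^ 2 ≤ M := by
      linarith [hfM x₁ t₁ ht₁, hf0 y₁ s₁ hs₁, hP x₁, hQ y₁]
    have h2 : H * (t₁ - s₁) ^ 2 * τ ^ 2 = (M + 1) * (t₁ - s₁) ^ 2 := by
      simp only [H]; field_simp
    have h3 : (t₁ - s₁) ^ 2 < τ ^ 2 := by
      have h4 : (M + 1) * (t₁ - s₁) ^ 2 ≤ M * τ ^ 2 := by
        rw [← h2]; exact mul_le_mul_of_nonneg_right h1 (sq_nonneg _)
      have h5 : 0 < τ ^ 2 := by positivity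
      nlinarith
    exact abs_lt_of_sq_lt_sq h3 hτ.le
  have hux : |f x₁ t₁ - f x₁ s₁| < α / 2 := by
    have := hunif (x₁, t₁) ⟨Or.inl hx₁, ht₁⟩ (x₁, s₁) ⟨Or.inl hx₁, hs₁⟩
      (by simpa [Prod.dist_eq, Real.dist_eq] using hts)
    simpa [Real.dist_eq] using this
  have huy : |f y₁ t₁ - f y₁ s₁| < α / 2 := by
    have := hunif (y₁, t₁) ⟨Or.inr hy₁, ht₁⟩ (y₁, s₁) ⟨Or.inr hy₁, hs₁⟩
      (by simpa [Prod.dist_eq, Real.dist_eq] using hts)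
    simpa [Real.dist_eq] using this
  rw [abs_lt] at hux huy
  have hNb := hN x₁ y₁ t₁ ht₁
  -- The maximum exceeds N - α. A zero time would bound it by N - 2α + α/2, and a penalty of at
  -- least 2α by N + α/2 - 2α.
  refine ⟨H, hH, x₁, y₁, t₁, ⟨lt_of_le_of_ne ht₁.1 fun h0 => ?_, ht₁.2⟩, s₁,
    ⟨lt_of_le_of_ne hs₁.1 fun h0 => ?_, hs₁.2⟩, ?_, ?_, hNα.trans hval, fun x y t ht s hs => ?_⟩
  · have := hinit x₁ y₁
    rw [← h0] at hval' huy hHn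
    linarith [hP x₁, hQ y₁, huy.1, huy.2]
  · have := hinit x₁ y₁
    rw [← h0] at hval' hux hHn
    linarith [hP x₁, hQ y₁, hux.1, hux.2]
  · by_contra! hx
    linarith [hP2 x₁ hx, hQ y₁, huy.1, huy.2]
  · by_contra! hy
    linarith [hQ2 y₁ hy, hP x₁, huy.1, huy.2]
  · by_cases hin : ((x, y), (t, s)) ∈ D
    -- Outside D one penalty reaches M, so the functional is nonpositive there.
    · exact hmax hin
    · refine le_trans ?_ (hNα.trans hval).le
      have h1 : 0 ≤ K * ‖x - y - h‖ ^ 2 := by positivity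
      have h2 : 0 ≤ H * (t - s) ^ 2 := by positivity
      have h3 : 0 ≤ l * t := mul_nonneg hl ht.1
      have h4 : M ≤ P x + Q y := by
        by_contra! hlt
        refine hin ⟨⟨?_, ?_⟩, ht, hs⟩
        · rw [Metric.mem_closedBall, dist_eq_norm]
          by_contra! hx
          linarith [hPM x hx.le, hQ y]
        · rw [Metric.mem_closedBall, dist_eq_norm]
          by_contra! hy
          linarith [hQM y hy.le, hP x]
      linarith [hfM x t ht, hf0 y s hs]

/-! ### The viscosity inequalities at the maximum -/

section Comparison

variable {d : ℕ} {γ : ℝ≥0} {J : (EuclideanSpace ℝ (Fin d) → ℝ) → EuclideanSpace ℝ (Fin d) → ℝ}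
  {T : ℝ} {f : EuclideanSpace ℝ (Fin d) → ℝ → ℝ}

/-- The consequence of the two viscosity inequalities at a maximum point of the doubling of
variables functional. -/
theorem exists_le_sub_of_doubling_max (hJ : IsNonlocalOperator γ J)
    (hf : IsViscositySolution γ J T f) {δ M : ℝ} (hδ : 0 < δ)
    (hfδ : ∀ x, ∀ t ∈ Icc 0 T, δ ≤ f x t) (hfM : ∀ x, ∀ t ∈ Icc 0 T, f x t ≤ M)
    {K l H B C : ℝ} (hK : 0 ≤ K) (hl : 0 ≤ l) (hH : 0 ≤ H)
    {P Q : EuclideanSpace ℝ (Fin d) → ℝ} (hP : IsC11 B C P) (hQ : IsC11 B C Q)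
    (hP0 : ∀ x, 0 ≤ P x) (hQ0 : ∀ x, 0 ≤ Q x)
    {h x₁ y₁ : EuclideanSpace ℝ (Fin d)} {t₁ s₁ : ℝ} (ht₁ : t₁ ∈ Ioc 0 T) (hs₁ : s₁ ∈ Ioc 0 T)
    (hpos : 0 < f x₁ t₁ - f y₁ s₁ - K * ‖x₁ - y₁ - h‖ ^ 2 - H * (t₁ - s₁) ^ 2 - l * t₁
      - P x₁ - Q y₁)
    (hmax : ∀ x y, ∀ t ∈ Icc 0 T, ∀ s ∈ Icc 0 T,
        f x t - f y s - K * ‖x - y - h‖ ^ 2 - H * (t - s) ^ 2 - l * t - P x - Q y ≤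
        f x₁ t₁ - f y₁ s₁ - K * ‖x₁ - y₁ - h‖ ^ 2 - H * (t₁ - s₁) ^ 2 - l * t₁ - P x₁ - Q y₁) :
    ∃ G : EuclideanSpace ℝ (Fin d) → ℝ,
      IsC11 (3 * M + 4 * B + δ / 2)
        ((δ / 2)⁻¹ * (2 * (2 * M + 4 * B) + (8 * K + C)) ^ 2 + (8 * K + C)) G ∧
      (∀ z, δ / 4 ≤ G z) ∧ l ≤ J (fun z => G z + (P (z + x₁) + Q (z + y₁))) 0 - J G 0 := by
  have hγ := hJ.gamma_lt_one
  have hδ2 : 0 < δ / 2 := by linarith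
  have ht₁' : t₁ ∈ Icc 0 T := ⟨ht₁.1.le, ht₁.2⟩
  have hs₁' : s₁ ∈ Icc 0 T := ⟨hs₁.1.le, hs₁.2⟩
  have hB0 := hP.bound_nonneg
  have hPB : ∀ x, P x ≤ B := fun x => (le_abs_self _).trans (hP.2.1 x)
  have hQB : ∀ x, Q x ≤ B := fun x => (le_abs_self _).trans (hQ.2.1 x)
  set q := t₁ - s₁ with hq
  obtain ⟨a, ha⟩ : ∃ a, a = f x₁ t₁ - P x₁ := ⟨_, rfl⟩
  obtain ⟨b, hb⟩ : ∃ b, b = f y₁ s₁ + Q y₁ := ⟨_, rfl⟩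
  have hab : 0 < a - b := by
    have h1 : 0 ≤ K * ‖x₁ - y₁ - h‖ ^ 2 := by positivity
    have h2 : 0 ≤ H * q ^ 2 := by positivity
    have h3 : 0 ≤ l * t₁ := mul_nonneg hl ht₁.1.le
    linarith
  have hne : Nonempty (EuclideanSpace ℝ (Fin d) × Icc 0 T) := ⟨(0, ⟨t₁, ht₁'⟩)⟩
  -- The index sets range over all times, so g is independent of time. Recentring by a and b makes
  -- both families vanish at the contact points, which pins g 0 = 0.
  obtain ⟨g, hgU, hgV, hgq⟩ := exists_interposition hK (x₁ - y₁ - h)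
    (fun i : EuclideanSpace ℝ (Fin d) × Icc 0 T => i.1 - x₁)
    (fun i => f i.1 i.2 - P i.1 - (l * (i.2 - t₁) + 2 * H * q * (i.2 - t₁) +
      2 * H * (i.2 - t₁) ^ 2) - a)
    (fun j : EuclideanSpace ℝ (Fin d) × Icc 0 T => j.1 - y₁)
    (fun j => f j.1 j.2 + Q j.1 - (2 * H * q * (j.2 - s₁) - 2 * H * (j.2 - s₁) ^ 2) - b)
    (by
      rintro ⟨x, t, ht⟩ ⟨y, s, hs⟩
      have h1 := hmax x y t ht s hs
      have e : x - x₁ - (y - y₁) = (x - y - h) - (x₁ - y₁ - h) := by abel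
      have e' : ∀ v p : EuclideanSpace ℝ (Fin d),
          2 * K * inner ℝ p (v - p) + K * ‖v - p‖ ^ 2 = K * ‖v‖ ^ 2 - K * ‖p‖ ^ 2 := fun v p => by
        rw [norm_sub_sq_real, inner_sub_right, real_inner_self_eq_norm_sq, real_inner_comm v p]
        ring
      simp only [e, e']
      -- The square of q + (t - t₁) - (s - s₁) is bounded by terms separated in t and s; their
      -- slopes at t₁ and s₁ are both 2 H q and cancel in the final comparison.
      have h2 : H * (t - s) ^ 2 ≤ H * (q ^ 2 + 2 * q * ((t - t₁) - (s - s₁))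
          + 2 * (t - t₁) ^ 2 + 2 * (s - s₁) ^ 2) := by
        refine mul_le_mul_of_nonneg_left ?_ hH
        rw [hq]
        nlinarith [sq_nonneg ((t - t₁) + (s - s₁))]
      rw [ha, hb]
      linarith)
  have hgU' : ∀ x, ∀ t ∈ Icc 0 T, f x t - P x - (l * (t - t₁) + 2 * H * q * (t - t₁) +
      2 * H * (t - t₁) ^ 2) - a ≤ g (x - x₁) := fun x t ht => hgU (x, ⟨t, ht⟩)
  have hgV' : ∀ y, ∀ s ∈ Icc 0 T, g (y - y₁) ≤
      f y s + Q y - (2 * H * q * (s - s₁) - 2 * H * (s - s₁) ^ 2) - b :=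
    fun y s hs => hgV (y, ⟨s, hs⟩)
  have hglow : ∀ z, f (z + x₁) t₁ - P (z + x₁) - a ≤ g z := fun z => by
    simpa using hgU' (z + x₁) t₁ ht₁'
  have hgup : ∀ z, g z ≤ f (z + y₁) s₁ + Q (z + y₁) - b := fun z => by
    simpa using hgV' (z + y₁) s₁ hs₁'
  have hg0 : g 0 = 0 := by
    have h1 := hglow 0
    have h2 := hgup 0
    rw [zero_add] at h1 h2
    linarith
  have hg : IsC11 (M + 2 * B) (8 * K) g := by
    refine ⟨by positivity, fun z => ?_, hgq⟩
    rw [abs_le]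
    constructor
    · linarith [hglow z, hfδ (z + x₁) t₁ ht₁', hPB (z + x₁), hfM x₁ t₁ ht₁', hP0 x₁]
    · linarith [hgup z, hfM (z + y₁) s₁ hs₁', hQB (z + y₁), hfδ y₁ s₁ hs₁', hQ0 y₁]
  have hψ₀ : IsC11 (2 * M + 4 * B) (8 * K + C) (fun z => b + g z + -Q (z + y₁)) := by
    refine (((IsC11.const b).add hg).add (hQ.comp_add_right y₁).neg).mono ?_ (by linarith)
    have : |b| ≤ M + B := by
      rw [abs_le]
      constructor <;> linarith [hfM y₁ s₁ hs₁', hfδ y₁ s₁ hs₁', hQ0 y₁, hQB y₁]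
    linarith
  have hG : IsC11 (3 * M + 4 * B + δ / 2)
        ((δ / 2)⁻¹ * (2 * (2 * M + 4 * B) + (8 * K + C)) ^ 2 + (8 * K + C))
        (fun z => lowerTrunc (δ / 2) (b + g z + -Q (z + y₁)) + (a - b)) := by
    refine ((hψ₀.lowerTrunc hδ2).add (IsC11.const (a - b))).mono ?_ (by linarith)
    rw [abs_of_pos hab]
    linarith [hfM x₁ t₁ ht₁', hP0 x₁, hfδ y₁ s₁ hs₁', hQ0 y₁]
  have hG4 : ∀ z, δ / 4 ≤ lowerTrunc (δ / 2) (b + g z + -Q (z + y₁)) := fun z => by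
    linarith [half_le_lowerTrunc hδ2 (b + g z + -Q (z + y₁))]
  have hdom : ∀ {B' C' : ℝ} {F : EuclideanSpace ℝ (Fin d) → ℝ}, IsC11 B' C' F →
      (∀ z, δ / 4 ≤ F z) → F ∈ domK d γ := fun {B' C' F} hF hF4 =>
    mem_domK (δ := δ / 4) (m := max (11 * B' + 10 * C') (δ / 2)) (by linarith)
      (lt_max_of_lt_right (by linarith)) (hF.mem_classK hγ.le hF4 (le_max_left _ _))
  refine ⟨_, hG, fun z => by linarith [hG4 z], ?_⟩
  -- the subsolution inequality
  have hφ := ((IsC11.const a).add (hg.comp_add_right (-x₁))).add hP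
  simp only [← sub_eq_add_neg] at hφ
  have hφf : ∀ x, f x t₁ ≤ a + g (x - x₁) + P x := fun x => by
    have := hgU' x t₁ ht₁'
    simp only [sub_self] at this
    linarith
  have hsub : l + 2 * H * q ≤ J (fun x => a + g (x - x₁) + P x) x₁ := by
    have hb₁ : HasDerivAt (fun t => l * (t - t₁) + 2 * H * q * (t - t₁) + 2 * H * (t - t₁) ^ 2)
        (l + 2 * H * q) t₁ := by
      have h1 : HasDerivAt (fun t => t - t₁) 1 t₁ := (hasDerivAt_id t₁).sub_const t₁
      have h2 := ((h1.const_mul l).add (h1.const_mul (2 * H * q))).add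
        ((h1.pow 2).const_mul (2 * H))
      exact h2.congr_deriv (by simp)
    have key := hf.1.2.2 x₁ t₁ ht₁ (fun x t => a + g (x - x₁) + P x +
        (l * (t - t₁) + 2 * H * q * (t - t₁) + 2 * H * (t - t₁) ^ 2))
      (hφ.isTestFunction hγ (by fun_prop)) (t₁ / 2) (by linarith [ht₁.1]) (by linarith [ht₁.1])
      (by simp only [sub_self, hg0, ha]; ring) fun y s hs => by
        have := hgU' y s ⟨by linarith [hs.1, ht₁.1], hs.2.trans ht₁.2⟩
        linarith
    rw [(hb₁.const_add _).deriv] at key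
    simpa using key
  have hφtr : J (fun z => a + g z + P (z + x₁)) 0 = J (fun x => a + g (x - x₁) + P x) x₁ := by
    have := hJ.translation _ (hdom hφ fun z => by linarith [hφf z, hfδ z t₁ ht₁']) x₁ 0
    simpa using this
  -- the supersolution inequality
  have hψ := hψ₀.comp_add_right (-y₁)
  simp only [← sub_eq_add_neg, sub_add_cancel] at hψ
  have hsup : J (fun y => lowerTrunc (δ / 2) (b + g (y - y₁) - Q y)) y₁ ≤ 2 * H * q := by
    have hb₁ : HasDerivAt (fun s => 2 * H * q * (s - s₁) - 2 * H * (s - s₁) ^ 2)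
        (2 * H * q) s₁ := by
      have h1 : HasDerivAt (fun t => t - s₁) 1 s₁ := (hasDerivAt_id s₁).sub_const s₁
      have h2 := (h1.const_mul (2 * H * q)).sub ((h1.pow 2).const_mul (2 * H))
      exact h2.congr_deriv (by simp)
    have key := hf.2.lowerTrunc_le hγ hδ hfδ hψ (x := y₁)
      (b := fun s => 2 * H * q * (s - s₁) - 2 * H * (s - s₁) ^ 2) (by fun_prop) hs₁
      (by simp) (by simp only [sub_self, hg0, hb]; ring) fun y s hs => by
        have := hgV' y s hs
        linarith
    rwa [hb₁.deriv] at key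
  have hψtr : J (fun z => lowerTrunc (δ / 2) (b + g z + -Q (z + y₁))) 0
      = J (fun y => lowerTrunc (δ / 2) (b + g (y - y₁) - Q y)) y₁ := by
    have := hJ.translation _ (hdom (hψ.lowerTrunc hδ2) fun z => by
      simpa [← sub_eq_add_neg] using hG4 (z - y₁)) y₁ 0
    simpa [← sub_eq_add_neg] using this
  -- Positivity of the maximum is needed exactly here: it makes a - b a positive constant.
  have hconst := hJ.add_const_le _ (hdom (hψ₀.lowerTrunc hδ2) hG4) (a - b) hab 0
  -- comparison of the two test functions
  have hgcp := hJ.gcp (fun z => a + g z + P (z + x₁))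
    (hdom (((IsC11.const a).add hg).add (hP.comp_add_right x₁)) fun z => by
      linarith [hglow z, hfδ (z + x₁) t₁ ht₁'])
    (fun z => lowerTrunc (δ / 2) (b + g z + -Q (z + y₁)) + (a - b) + (P (z + x₁) + Q (z + y₁)))
    (hdom (hG.add ((hP.comp_add_right x₁).add (hQ.comp_add_right y₁))) fun z => by
      linarith [hG4 z, hP0 (z + x₁), hQ0 (z + y₁)])
    (fun z => by linarith [le_lowerTrunc hδ2 (b + g z + -Q (z + y₁))]) 0 (by
      have e : b + g 0 + -Q (0 + y₁) = f y₁ s₁ := by rw [hg0, zero_add, hb]; ring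
      rw [e, lowerTrunc_of_le hδ2 (by linarith [hfδ y₁ s₁ hs₁']), hg0, zero_add, zero_add, hb]
      ring)
  linarith

end Comparison

/-! ### Choice of constants and contradiction -/

theorem IsViscositySolution.sub_le {d : ℕ} {γ : ℝ≥0}
    {J : (EuclideanSpace ℝ (Fin d) → ℝ) → EuclideanSpace ℝ (Fin d) → ℝ} {T : ℝ}
    {f : EuclideanSpace ℝ (Fin d) → ℝ → ℝ} (hJ : IsNonlocalOperator γ J) (hT : 0 < T)
    (hf_cont : ContinuousOn (Function.uncurry f) (univ ×ˢ Icc 0 T))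
    (hf_bdd : ∃ M, ∀ x, ∀ t ∈ Icc 0 T, f x t ≤ M)
    (hf : IsViscositySolution γ J T f) {ω : ℝ → ℝ} (hω : IsModulus ω)
    (hf₀ : ∀ x y, |f x 0 - f y 0| ≤ ω ‖x - y‖) {t : ℝ} (ht : t ∈ Icc 0 T)
    (x y : EuclideanSpace ℝ (Fin d)) : f x t - f y t ≤ ω ‖x - y‖ := by
  by_contra! hlt
  have hT0 : (0 : ℝ) ∈ Icc 0 T := ⟨le_rfl, hT.le⟩
  obtain ⟨M, hfM⟩ := hf_bdd
  obtain ⟨δ, hδ, hfδ⟩ := hf.1.2.1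
  have hM : 0 < M := by linarith [hfδ 0 0 hT0, hfM 0 0 hT0]
  set h := x - y with hh
  have hc : 0 ≤ ω ‖h‖ := (abs_nonneg _).trans (hf₀ x y)
  set ν := (f x t - f y t - ω ‖h‖) / 2 with hν
  have hν0 : 0 < ν := by linarith
  -- The loss l t is at most ν, half of the excess, so the supremum N stays above ω ‖h‖ + ν.
  set l := ν / T with hl
  have hl0 : 0 < l := by positivity
  -- the strength of the spatial coupling
  obtain ⟨r₀, hr₀, hωr⟩ : ∃ r₀ > 0, ∀ r, 0 ≤ r → r < r₀ → ω r ≤ ν / 4 := by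
    have := hω.2.eventually (ge_mem_nhds (show (0 : ℝ) < ν / 4 by linarith))
    obtain ⟨r₀, hr₀, hsub⟩ := mem_nhdsGT_iff_exists_Ioo_subset.1 this
    refine ⟨r₀, hr₀, fun r hr hrr => ?_⟩
    rcases hr.eq_or_lt with rfl | hr
    · rw [hω.1]; linarith
    · exact hsub ⟨hr, hrr⟩
  -- If ‖x' - y' - h‖ ≥ r₀ the coupling is at least M. Otherwise the intermediate point y' + h
  -- splits the increment into ω ‖h‖ and a part of size at most ν/4.
  obtain ⟨K, hK⟩ : ∃ K, K = M / r₀ ^ 2 := ⟨_, rfl⟩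
  have hK0 : 0 ≤ K := by rw [hK]; positivity
  have hinit : ∀ x y, f x 0 - f y 0 - K * ‖x - y - h‖ ^ 2 ≤ ω ‖h‖ + ν / 4 := fun x' y' => by
    have hn : 0 ≤ K * ‖x' - y' - h‖ ^ 2 := by positivity
    rcases lt_or_ge ‖x' - y' - h‖ r₀ with hr | hr
    · have h1 := (abs_le.1 (hf₀ x' (y' + h))).2
      have h2 := (abs_le.1 (hf₀ (y' + h) y')).2
      rw [← sub_sub] at h1
      rw [add_sub_cancel_left] at h2
      linarith [hωr _ (norm_nonneg _) hr]
    · have h1 : M ≤ K * ‖x' - y' - h‖ ^ 2 := by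
        calc M = K * r₀ ^ 2 := by rw [hK]; field_simp
          _ ≤ _ := by gcongr
      linarith [hfM x' 0 hT0, hfδ y' 0 hT0]
  -- the supremum
  let ι := (EuclideanSpace ℝ (Fin d) × EuclideanSpace ℝ (Fin d)) × Icc 0 T
  let F : ι → ℝ := fun i => f i.1.1 i.2 - f i.1.2 i.2 - K * ‖i.1.1 - i.1.2 - h‖ ^ 2 - l * i.2
  have hF : BddAbove (range F) := by
    refine ⟨M, ?_⟩
    rintro _ ⟨⟨⟨x', y'⟩, s, hs⟩, rfl⟩
    have h1 : 0 ≤ K * ‖x' - y' - h‖ ^ 2 := by positivity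
    have h2 : 0 ≤ l * s := mul_nonneg hl0.le hs.1
    simp only [F]
    linarith [hfM x' s hs, hfδ y' s hs]
  obtain ⟨N, hN⟩ : ∃ N, N = ⨆ i, F i := ⟨_, rfl⟩
  have hNle : ∀ x y, ∀ t ∈ Icc 0 T,
      f x t - f y t - K * ‖x - y - h‖ ^ 2 - l * t ≤ N := fun x' y' s hs => by
    rw [hN]; exact le_ciSup hF ((x', y'), ⟨s, hs⟩)
  have hNge : ω ‖h‖ + ν ≤ N := by
    have h1 := hNle x y t ht
    rw [← hh, sub_self, norm_zero] at h1
    have h2 : l * t ≤ ν := by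
      calc l * t ≤ l * T := by gcongr; exact ht.2
        _ = ν := by rw [hl]; field_simp
    linarith
  -- the constants of the operator
  obtain ⟨Cχ, χ, hχ, hχ0, hχ1, hχ2⟩ := exists_isC11_cutoff (E := EuclideanSpace ℝ (Fin d))
  have hCχ := hχ.1
  obtain ⟨B, hB⟩ : ∃ B, B = 2 + M := ⟨_, rfl⟩
  obtain ⟨C, hC⟩ : ∃ C, C = (2 + M) * Cχ := ⟨_, rfl⟩
  have hB0 : 0 ≤ B := by rw [hB]; positivity
  have hC0 : 0 ≤ C := by rw [hC]; positivity
  obtain ⟨BG, hBG⟩ : ∃ BG, BG = 3 * M + 4 * B + δ / 2 := ⟨_, rfl⟩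
  obtain ⟨CG, hCG⟩ : ∃ CG, CG = (δ / 2)⁻¹ * (2 * (2 * M + 4 * B) + (8 * K + C)) ^ 2
    + (8 * K + C) := ⟨_, rfl⟩
  have hBG0 : 0 ≤ BG := by rw [hBG]; positivity
  have hCG0 : 0 ≤ CG := by rw [hCG]; positivity
  -- This m accommodates G together with both penalties, for every α ≤ 1 and R ≥ 1, so A and R' can
  -- be fixed before those parameters.
  obtain ⟨m, hm⟩ : ∃ m, m = 11 * (BG + 2 * B) + 10 * (CG + 2 * C) + δ := ⟨_, rfl⟩
  have hδ4 : 0 < δ / 4 := by linarith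
  have hδm : δ / 4 < m := by
    have : 0 ≤ 11 * (BG + 2 * B) + 10 * (CG + 2 * C) := by positivity
    linarith
  have hmem : ∀ {G : EuclideanSpace ℝ (Fin d) → ℝ}, IsC11 (BG + 2 * B) (CG + 2 * C) G →
      (∀ z, δ / 4 ≤ G z) → G ∈ classK d γ (δ / 4) m := fun hG hG4 =>
    hG.mem_classK hJ.gamma_lt_one.le hG4 (by linarith)
  obtain ⟨A, hA0, hA⟩ := hJ.exists_abs_sub_le hδ4 hδm
  obtain ⟨R', hR', hsplit⟩ := hJ.exists_abs_sub_le_of_eqOn_ball hδ4 hδm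
    (D := 2 * M) (ε := l / 4) (by positivity) (by positivity)
  -- The penalties are centred at x₀ and y₀, within 2 of x₁ and y₁. The margin 2 makes the recentred
  -- L vanish on the ball of radius 2 R'.
  obtain ⟨R, hR⟩ : ∃ R, R = 2 * R' + 2 := ⟨_, rfl⟩
  have hR1 : 1 ≤ R := by linarith
  have hR0 : 0 < R := by linarith
  -- the size of the small penalty
  obtain ⟨α, hα0, hα1, hαν, hαl⟩ : ∃ α : ℝ, 0 < α ∧ α ≤ 1 ∧ α ≤ ν / 4 ∧
      A * (44 + 40 * Cχ) * α ≤ l / 4 := by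
    have hA' : 0 ≤ A * (44 + 40 * Cχ) := by positivity
    refine ⟨min 1 (min (ν / 4) (l / 4 / (A * (44 + 40 * Cχ) + 1))), by positivity,
      min_le_left _ _, (min_le_right _ _).trans (min_le_left _ _), ?_⟩
    calc A * (44 + 40 * Cχ) * min 1 (min (ν / 4) (l / 4 / (A * (44 + 40 * Cχ) + 1)))
        ≤ (A * (44 + 40 * Cχ) + 1) * (l / 4 / (A * (44 + 40 * Cχ) + 1)) := by
          gcongr
          · linarith
          · exact (min_le_right _ _).trans (min_le_right _ _)
      _ = l / 4 := by field_simp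
  -- the penalties
  let S : EuclideanSpace ℝ (Fin d) → ℝ := fun v => 2 * α * χ v
  let L : EuclideanSpace ℝ (Fin d) → ℝ := fun v => M * χ (R⁻¹ • v)
  have hS : IsC11 (2 * α) (2 * α * Cχ) S := by
    simpa using hχ.const_mul (a := 2 * α) (by positivity)
  have hL : IsC11 M (M * Cχ) L := by
    have hR' : |R⁻¹| ≤ 1 := by rw [abs_of_pos (by positivity)]; exact inv_le_one_of_one_le₀ hR1
    simpa using (hχ.comp_smul hR').const_mul hM.le
  have hS0 : ∀ v, 0 ≤ S v := fun v => mul_nonneg (by positivity) (hχ0 v)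
  have hL0 : ∀ v, 0 ≤ L v := fun v => mul_nonneg hM.le (hχ0 _)
  have hLR : ∀ v, ‖v‖ ≤ R → L v = 0 := fun v hv => by
    simp only [L]
    rw [hχ1 _ (by rwa [norm_smul, Real.norm_eq_abs, abs_of_pos (by positivity),
      inv_mul_le_iff₀ hR0, mul_one]), mul_zero]
  have hPenalty : IsC11 B C (fun v => S v + L v) := by
    refine (hS.add hL).mono (by linarith) ?_
    rw [hC, add_mul]
    gcongr
    linarith
  have hP : ∀ v, IsC11 B C (fun z => S (z + v) + L (z + v)) := fun v =>
    hPenalty.comp_add_right v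
  have hSL2 : ∀ v, 2 ≤ ‖v‖ → 2 * α ≤ S v + L v := fun v hv => by
    have : S v = 2 * α := by simp only [S]; rw [hχ2 v hv, mul_one]
    linarith [hL0 v]
  have hSLR : ∀ v, 2 * R ≤ ‖v‖ → M ≤ S v + L v := fun v hv => by
    have : L v = M := by
      simp only [L]
      rw [hχ2 _ (by rwa [norm_smul, Real.norm_eq_abs, abs_of_pos (by positivity),
        le_inv_mul_iff₀ hR0, mul_comm]), mul_one]
    linarith [hS0 v]
  have hSL00 : S 0 + L 0 = 0 := by
    rw [hLR 0 (by simpa using hR0.le)]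
    simp only [S]; rw [hχ1 0 (by simp)]; ring
  -- the maximum point
  have : Nonempty ι := ⟨((x, y), ⟨t, ht⟩)⟩
  obtain ⟨⟨⟨x₀, y₀⟩, t₀, ht₀⟩, hi₀⟩ : ∃ i, N - α < F i :=
    exists_lt_of_lt_ciSup (by rw [← hN]; linarith)
  obtain ⟨H, hH, x₁, y₁, t₁, ht₁, s₁, hs₁, hx₁, hy₁, hpos, hmax⟩ :=
    exists_doubling_max (P := fun z => S (z + -x₀) + L (z + -x₀))
      (Q := fun z => S (z + -y₀) + L (z + -y₀)) (ρ := 2 * R) hf_cont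
      (fun x t ht => hδ.le.trans (hfδ x t ht)) hfM hM.le hK0 hl0.le hα0 (by linarith)
      (by positivity) hNle ht₀ hi₀ (fun x y => (hinit x y).trans (by linarith))
      (hP _).differentiable.continuous (hP _).differentiable.continuous
      (fun z => add_nonneg (hS0 _) (hL0 _)) (fun z => add_nonneg (hS0 _) (hL0 _))
      (by simpa using hSL00) (by simpa using hSL00)
      (fun z hz => hSL2 _ (by rwa [← sub_eq_add_neg]))
      (fun z hz => hSL2 _ (by rwa [← sub_eq_add_neg]))
      (fun z hz => hSLR _ (by rwa [← sub_eq_add_neg]))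
      (fun z hz => hSLR _ (by rwa [← sub_eq_add_neg]))
  obtain ⟨G, hG, hG4, hle⟩ := exists_le_sub_of_doubling_max hJ hf hδ hfδ hfM hK0 hl0.le hH
    (hP (-x₀)) (hP (-y₀)) (fun z => add_nonneg (hS0 _) (hL0 _))
    (fun z => add_nonneg (hS0 _) (hL0 _)) ht₁ hs₁ hpos hmax
  rw [← hBG, ← hCG] at hG
  simp only [add_assoc] at hle
  set p := x₁ + -x₀ with hp
  set q := y₁ + -y₀ with hq
  have hp2 : ‖p‖ < 2 := by rwa [hp, ← sub_eq_add_neg]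
  have hq2 : ‖q‖ < 2 := by rwa [hq, ← sub_eq_add_neg]
  -- the penalties contribute little
  have hSS := (hS.comp_add_right p).add (hS.comp_add_right q)
  have hmem₁ : G ∈ classK d γ (δ / 4) m := hmem (hG.mono (by linarith) (by linarith)) hG4
  have hmem₂ : (fun z => G z + (S (z + p) + S (z + q))) ∈ classK d γ (δ / 4) m := by
    refine hmem ((hG.add hSS).mono (by linarith) ?_) fun z => by
      linarith [hG4 z, hS0 (z + p), hS0 (z + q)]
    have : 2 * α * Cχ ≤ C := by rw [hC]; gcongr; linarith
    linarith
  have hmem₃ : (fun z => G z + (S (z + p) + (L (z + p) + (S (z + q) + L (z + q)))))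
      ∈ classK d γ (δ / 4) m := by
    have h1 := hG.add ((hP p).add (hP q))
    simp only [add_assoc] at h1
    exact hmem (h1.mono (by linarith) (by linarith)) fun z => by
      linarith [hG4 z, hS0 (z + p), hS0 (z + q), hL0 (z + p), hL0 (z + q)]
  -- Adding the two S terms to G costs at most l/4, and adding the two L terms afterwards at most
  -- another l/4, against the required l.
  have hsmall := hA _ hmem₂ _ hmem₁ (2 * α + 2 * α) (2 * α * Cχ + 2 * α * Cχ) (by
    refine ⟨hSS.1, fun z => ?_, fun z => ?_⟩
    · simpa using hSS.2.1 z
    · simpa using hSS.2.2 z) 0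
  have hlarge := hsplit _ hmem₃ _ hmem₂ (fun z hz => by
      have h1 : L (z + p) = 0 := hLR _ ((norm_add_le _ _).trans (by linarith))
      have h2 : L (z + q) = 0 := hLR _ ((norm_add_le _ _).trans (by linarith))
      rw [h1, h2]; ring) (fun z => by
      have h1 := (le_abs_self _).trans (hL.2.1 (z + p))
      have h2 := (le_abs_self _).trans (hL.2.1 (z + q))
      rw [abs_le]
      constructor <;> linarith [hL0 (z + p), hL0 (z + q)])
  have h1 := (abs_le.1 hsmall).2
  have h2 := (abs_le.1 hlarge).2
  have h3 : A * (11 * (2 * α + 2 * α) + 10 * (2 * α * Cχ + 2 * α * Cχ))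
      = A * (44 + 40 * Cχ) * α := by ring
  linarith

theorem lemma10p1 {d : ℕ} (γ : ℝ≥0)
    (J : (EuclideanSpace ℝ (Fin d) → ℝ) → EuclideanSpace ℝ (Fin d) → ℝ)
    (hJ : IsNonlocalOperator γ J)
    (T : ℝ) (hT : 0 < T)
    (f : EuclideanSpace ℝ (Fin d) → ℝ → ℝ) (f₀ : EuclideanSpace ℝ (Fin d) → ℝ)
    (hf_cont : ContinuousOn (Function.uncurry f) (univ ×ˢ Icc 0 T))
    (hf_bdd : ∃ M, ∀ x, ∀ t ∈ Icc 0 T, f x t ≤ M)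
    (hf_sol : IsViscositySolution γ J T f)
    (hf_init : ∀ x, f x 0 = f₀ x)
    (ω : ℝ → ℝ) (hω : IsModulus ω)
    (hf₀ : ∀ x y, |f₀ x - f₀ y| ≤ ω ‖x - y‖) :
    ∀ t ∈ Icc 0 T, ∀ x y, |f x t - f y t| ≤ ω ‖x - y‖ := by
  intro t ht x y
  simp only [← hf_init] at hf₀
  refine abs_sub_le_iff.2 ⟨hf_sol.sub_le hJ hT hf_cont hf_bdd hω hf₀ ht x y, ?_⟩
  rw [norm_sub_rev]
  exact hf_sol.sub_le hJ hT hf_cont hf_bdd hω hf₀ ht y x
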